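/- Let $0<s_1<s_2<s_3$ with $s_1+s_2+s_3=1$ and $S=\mathrm{diag}(s_1,s_2,s_3)$. **Attainable fields.** Let $K(S)=\{\lambda R^tSR:\lambda\in\mathbb R,\ R\in SO(3)\}$ and $C=[0,1]^3$, and let $W^{1,2}_C(\mathbb R^3;\mathbb R^3)$ be the space of $C$-periodic fields in $W^{1,2}_{\rm loc}(\mathbb R^3;\mathbb R^3)$. Let $K^{app}(S)$ be the set of symmetric real $3\times3$ matrices $A$ for which there is a sequence $(u_j)$ with $u_j-Ax\in W^{1,2}_C(\mathbb R^3;\mathbb R^3)$, bounded in $W^{1,2}_{\rm loc}$, such that $(\nabla u_j)$ is $L^2_{\rm loc}$-equi-integrable and $\mathrm{dist}(\nabla u_j,K(S))\to0$ locally in measure. Let $$K^*(S)=\Big\{A\in K^{app}(S): A=\mathrm{diag}(a_1,a_2,a_3),\ a_i\in[s_1,s_3],\ \textstyle\sum_i a_i=1\Big\},$$ identified with a set of points $(a_1,a_2,a_3)\in\mathbb R^3$. **The set $\mathcal L(S)$.** Let $u_\alpha$ and $u_\beta$ be the smallest and the greatest root of $$H(x)=6s_2x^2+x(s_1s_3-3s_2-4s_2^2)+2s_2^2,$$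 and put $\alpha=u_\alpha/s_2$, $\beta=u_\beta/s_2$, $U_\alpha=\mathrm{diag}(u_\alpha,u_\alpha,1-2u_\alpha)$, $U_\beta=\mathrm{diag}(1-2u_\beta,u_\beta,u_\beta)$. For $\gamma\in\{\alpha,\beta\}$ let $$\cos(2\varphi_\gamma)=\frac{2s_2(3s_2-1)+u_\gamma(1+s_1^2-9s_2^2-2s_1s_3+s_3^2)}{2(s_3-s_1)(s_2-u_\gamma)},$$ and let $\theta_\alpha,\theta_\beta$ be angles with $$\cos(2\theta_\alpha)=\frac{u_\alpha(s_3-s_1)+(u_\alpha-s_2)\cos(2\varphi_\alpha)}{s_2(1-3u_\alpha)},\qquad \cos(2\theta_\beta)=\frac{u_\beta(s_1-s_3)+(s_2-u_\beta)\cos(2\varphi_\beta)}{s_2(1-3u_\beta)}.$$ Put $$R_\alpha=\begin{pmatrix}0&-1&0\\-\cos\theta_\alpha&0&\sin\theta_\alpha\\-\sin\theta_\alpha&0&-\cos\theta_\alpha\end{pmatrix},\qquad R_\beta=\begin{pmatrix}\cos\theta_\beta&0&-\sin\theta_\beta\\\sin\theta_\beta&0&\cos\theta_\beta\\0&-1&0\end{pmatrix},$$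 and, for $\gamma\in\{\alpha,\beta\}$ and $p\in[0,1]$, $$M_\gamma(p)=\eta_\gamma(p)\,R_\gamma^tU_\gamma R_\gamma+(1-\eta_\gamma(p))\,S,\qquad \eta_\gamma(p)=\frac{p}{p+(1-p)\gamma}.$$ Let $\Gamma_\gamma\subset\mathbb R^3$ be the curve $\{(m_1,m_2,m_3)\}$ of the increasingly ordered eigenvalues $m_1\le m_2\le m_3$ of $M_\gamma(p)$, $p\in[0,1]$. In the plane $m_1+m_2+m_3=1$, let $\Gamma$ be the closed curve formed by $\Gamma_\alpha$ and its reflection along the line $m_1=m_2$, by $\Gamma_\beta$ and its reflection along the line $m_2=m_3$, and by the copies of all these under rotation by $2\pi/3$ and $4\pi/3$ about $(\tfrac13,\tfrac13,\tfrac13)$. Let $\mathcal L(S)$ be the bounded closed set enclosed by $\Gamma$ in that plane, i.e. $\Gamma$ together with the points of the plane that lie in a bounded connected component of the complement of $\Gamma$. **Theorem.** $\mathcal L(S)\subset K^*(S)$; that is, $\mathrm{diag}(m_1,m_2,m_3)\in K^*(S)$ for every $(m_1,m_2,m_3)\in\mathcal L(S)$. -/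

import Mathlib

open MeasureTheory Filter Topology
open scoped Matrix NNReal ENNReal ContDiff

/- Spaces of `3 × 3` matrices carry the Frobenius (Euclidean) norm. -/
attribute [local instance] Matrix.frobeniusNormedAddCommGroup Matrix.frobeniusNormedSpace

noncomputable section

namespace Polycrystal

/-- Euclidean three-space. -/
abbrev E3 : Type := EuclideanSpace ℝ (Fin 3)

/-- Real `3 × 3` matrices. -/
abbrev M3 : Type := Matrix (Fin 3) (Fin 3) ℝ

/-! ### Sobolev fields and approximate average fields -/

/-- The linear map `x ↦ A x` on Euclidean three-space. -/
def linearField (A : M3) (x : E3) : E3 := WithLp.toLp 2 (A *ᵥ WithLp.ofLp x)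

/-- `u ∈ W^{1,2}_loc(ℝ³; ℝ³)` with weak gradient `G`, where `G i k = ∂ u_i / ∂ x_k`:
both are square integrable on compact sets and the integration by parts formula holds against
every smooth compactly supported test function. -/
structure HasWeakGradient (u : E3 → E3) (G : E3 → M3) : Prop where
  memLp : ∀ Q : Set E3, IsCompact Q → MemLp u 2 (volume.restrict Q)
  memLp_grad : ∀ Q : Set E3, IsCompact Q → MemLp G 2 (volume.restrict Q)
  integral_eq : ∀ φ : E3 → ℝ, ContDiff ℝ ∞ φ → HasCompactSupport φ → ∀ i k : Fin 3,
    ∫ x, u x i * fderiv ℝ φ x (EuclideanSpace.single k 1) = - ∫ x, G x i k * φ x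

/-- The space `W^{1,2}_C(ℝ³; ℝ³)` of fields in `W^{1,2}_loc(ℝ³; ℝ³)` that are periodic with
respect to the unit cube `C = [0,1]³`. -/
def periodicSobolev : Set (E3 → E3) :=
  {v | (∃ G, HasWeakGradient v G) ∧
    ∀ i : Fin 3, ∀ᵐ x, v (x + EuclideanSpace.single i 1) = v x}

/-- `K(S) = {λ Rᵗ S R : λ ∈ ℝ, R ∈ SO(3)}`. -/
def K (S : M3) : Set M3 :=
  {B | ∃ (c : ℝ) (R : M3), R ∈ Matrix.specialOrthogonalGroup (Fin 3) ℝ ∧ B = c • (Rᵀ * S * R)}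

/-- `K^app(S)`: the symmetric matrices `A` for which the inclusion `∇u ∈ K(S)`,
`u - A x ∈ W^{1,2}_C`, has an approximate solution, that is, a sequence `u j` with gradients `Du j`
such that `u j - A x ∈ W^{1,2}_C`, bounded in `W^{1,2}_loc`, with gradients equi-integrable in
`L²_loc`, and `dist (∇ u j, K(S)) → 0` locally in measure. -/
def Kapp (S : M3) : Set M3 :=
  {A | A.IsSymm ∧ ∃ (u : ℕ → E3 → E3) (Du : ℕ → E3 → M3),
    (∀ j, HasWeakGradient (u j) (Du j)) ∧
    (∀ j, (fun x => u j x - linearField A x) ∈ periodicSobolev) ∧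
    (∀ Q : Set E3, IsCompact Q → ∃ c : ℝ≥0, ∀ j,
      eLpNorm (u j) 2 (volume.restrict Q) ≤ c ∧ eLpNorm (Du j) 2 (volume.restrict Q) ≤ c) ∧
    (∀ Q : Set E3, IsCompact Q → UnifIntegrable Du 2 (volume.restrict Q)) ∧
    (∀ Q : Set E3, IsCompact Q →
      TendstoInMeasure (volume.restrict Q) (fun j x => Metric.infDist (Du j x) (K S)) atTop
        (fun _ => (0 : ℝ)))}

/-- The crystal `S = diag(s₁, s₂, s₃)`. -/
def crystal (s₁ s₂ s₃ : ℝ) : M3 := Matrix.diagonal ![s₁, s₂, s₃]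

/-- `K*(S)`: the diagonal elements of `K^app(S)` of trace one with diagonal entries in
`[s₁, s₃]`. -/
def Kstar (s₁ s₂ s₃ : ℝ) : Set M3 :=
  {A | A ∈ Kapp (crystal s₁ s₂ s₃) ∧ ∃ a : Fin 3 → ℝ,
    A = Matrix.diagonal a ∧ (∀ i, a i ∈ Set.Icc s₁ s₃) ∧ ∑ i, a i = 1}

/-! ### The curves and the set they enclose -/

/-- `H(x) = 6 s₂ x² + x (s₁ s₃ - 3 s₂ - 4 s₂²) + 2 s₂²`. -/
def H (s₁ s₂ s₃ x : ℝ) : ℝ := 6 * s₂ * x ^ 2 + x * (s₁ * s₃ - 3 * s₂ - 4 * s₂ ^ 2) + 2 * s₂ ^ 2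

/-- The smallest root of `H`. -/
def uα (s₁ s₂ s₃ : ℝ) : ℝ := sInf {x | H s₁ s₂ s₃ x = 0}

/-- The greatest root of `H`. -/
def uβ (s₁ s₂ s₃ : ℝ) : ℝ := sSup {x | H s₁ s₂ s₃ x = 0}

/-- The uniaxial matrix `U_α`. -/
def Uα (s₁ s₂ s₃ : ℝ) : M3 :=
  Matrix.diagonal ![uα s₁ s₂ s₃, uα s₁ s₂ s₃, 1 - 2 * uα s₁ s₂ s₃]

/-- The uniaxial matrix `U_β`. -/
def Uβ (s₁ s₂ s₃ : ℝ) : M3 :=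
  Matrix.diagonal ![1 - 2 * uβ s₁ s₂ s₃, uβ s₁ s₂ s₃, uβ s₁ s₂ s₃]

/-- The common expression for `cos (2 φ_α)` (at `u = u_α`) and `cos (2 φ_β)` (at `u = u_β`). -/
def cosTwoφ (s₁ s₂ s₃ u : ℝ) : ℝ :=
  (2 * s₂ * (3 * s₂ - 1) + u * (1 + s₁ ^ 2 - 9 * s₂ ^ 2 - 2 * s₁ * s₃ + s₃ ^ 2)) /
    (2 * (s₃ - s₁) * (s₂ - u))

/-- `cos (2 θ_α)`. -/
def cosTwoθα (s₁ s₂ s₃ : ℝ) : ℝ :=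
  (uα s₁ s₂ s₃ * (s₃ - s₁) + (uα s₁ s₂ s₃ - s₂) * cosTwoφ s₁ s₂ s₃ (uα s₁ s₂ s₃)) /
    (s₂ * (1 - 3 * uα s₁ s₂ s₃))

/-- `cos (2 θ_β)`. -/
def cosTwoθβ (s₁ s₂ s₃ : ℝ) : ℝ :=
  (uβ s₁ s₂ s₃ * (s₁ - s₃) + (s₂ - uβ s₁ s₂ s₃) * cosTwoφ s₁ s₂ s₃ (uβ s₁ s₂ s₃)) /
    (s₂ * (1 - 3 * uβ s₁ s₂ s₃))

/-- An angle `θ_α` with the prescribed `cos (2 θ_α)`. Another choice of angle changes at most the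
sign of the off-diagonal entries of `Rᵗ U R`, hence leaves the curves below unchanged. -/
def θα (s₁ s₂ s₃ : ℝ) : ℝ := Real.arccos (cosTwoθα s₁ s₂ s₃) / 2

/-- An angle `θ_β` with the prescribed `cos (2 θ_β)`. -/
def θβ (s₁ s₂ s₃ : ℝ) : ℝ := Real.arccos (cosTwoθβ s₁ s₂ s₃) / 2

/-- The rotation `R_α`. -/
def Rα (s₁ s₂ s₃ : ℝ) : M3 :=
  !![0, -1, 0;
     -Real.cos (θα s₁ s₂ s₃), 0, Real.sin (θα s₁ s₂ s₃);
     -Real.sin (θα s₁ s₂ s₃), 0, -Real.cos (θα s₁ s₂ s₃)]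

/-- The rotation `R_β`. -/
def Rβ (s₁ s₂ s₃ : ℝ) : M3 :=
  !![Real.cos (θβ s₁ s₂ s₃), 0, -Real.sin (θβ s₁ s₂ s₃);
     Real.sin (θβ s₁ s₂ s₃), 0, Real.cos (θβ s₁ s₂ s₃);
     0, -1, 0]

/-- The weight `η(p) = p / (p + (1 - p) a)`. -/
def η (a p : ℝ) : ℝ := p / (p + (1 - p) * a)

/-- `M_α(p) = η(p) R_αᵗ U_α R_α + (1 - η(p)) S`, with `η` formed with `α = u_α / s₂`. -/
def Mα (s₁ s₂ s₃ p : ℝ) : M3 :=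
  η (uα s₁ s₂ s₃ / s₂) p • ((Rα s₁ s₂ s₃)ᵀ * Uα s₁ s₂ s₃ * Rα s₁ s₂ s₃) +
    (1 - η (uα s₁ s₂ s₃ / s₂) p) • crystal s₁ s₂ s₃

/-- `M_β(p) = η(p) R_βᵗ U_β R_β + (1 - η(p)) S`, with `η` formed with `β = u_β / s₂`. -/
def Mβ (s₁ s₂ s₃ p : ℝ) : M3 :=
  η (uβ s₁ s₂ s₃ / s₂) p • ((Rβ s₁ s₂ s₃)ᵀ * Uβ s₁ s₂ s₃ * Rβ s₁ s₂ s₃) +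
    (1 - η (uβ s₁ s₂ s₃ / s₂) p) • crystal s₁ s₂ s₃

/-- `m = (m₁, m₂, m₃)` lists the eigenvalues of `M`, with multiplicity, in increasing order. -/
def IsOrderedEigenvalues (M : M3) (m : Fin 3 → ℝ) : Prop :=
  Monotone m ∧ M.charpoly = ∏ i, (Polynomial.X - Polynomial.C (m i))

/-- The curve `Γ_α` of ordered eigenvalues of `M_α(p)`, `p ∈ [0,1]`. -/
def Γα (s₁ s₂ s₃ : ℝ) : Set (Fin 3 → ℝ) :=
  {m | ∃ p ∈ Set.Icc (0 : ℝ) 1, IsOrderedEigenvalues (Mα s₁ s₂ s₃ p) m}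

/-- The curve `Γ_β` of ordered eigenvalues of `M_β(p)`, `p ∈ [0,1]`. -/
def Γβ (s₁ s₂ s₃ : ℝ) : Set (Fin 3 → ℝ) :=
  {m | ∃ p ∈ Set.Icc (0 : ℝ) 1, IsOrderedEigenvalues (Mβ s₁ s₂ s₃ p) m}

/-- The unit-trace plane `m₁ + m₂ + m₃ = 1`. -/
def unitTracePlane : Set (Fin 3 → ℝ) := {m | ∑ i, m i = 1}

/-- The reflection of the unit-trace plane along the line `m₁ = m₂`. -/
def reflect₁₂ (m : Fin 3 → ℝ) : Fin 3 → ℝ := ![m 1, m 0, m 2]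

/-- The reflection of the unit-trace plane along the line `m₂ = m₃`. -/
def reflect₂₃ (m : Fin 3 → ℝ) : Fin 3 → ℝ := ![m 0, m 2, m 1]

/-- The rotation of the unit-trace plane by the angle `2π/3`. -/
def rotate (m : Fin 3 → ℝ) : Fin 3 → ℝ := ![m 2, m 0, m 1]

/-- The closed curve `Γ`: `Γ_α` with its reflection along `m₁ = m₂`, `Γ_β` with its reflection
along `m₂ = m₃`, and the rotated copies of these by multiples of `2π/3`. -/
def Γ (s₁ s₂ s₃ : ℝ) : Set (Fin 3 → ℝ) :=
  ⋃ k : Fin 3, rotate^[(k : ℕ)] ''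
    ((Γα s₁ s₂ s₃ ∪ reflect₁₂ '' Γα s₁ s₂ s₃) ∪ (Γβ s₁ s₂ s₃ ∪ reflect₂₃ '' Γβ s₁ s₂ s₃))

/-- `ℒ(S)`: the bounded closed set enclosed by `Γ` in the unit-trace plane, that is, `Γ` together
with the points of the plane whose connected component in the complement of `Γ` is bounded. -/
def L (s₁ s₂ s₃ : ℝ) : Set (Fin 3 → ℝ) :=
  {m | m ∈ unitTracePlane ∧ (m ∈ Γ s₁ s₂ s₃ ∨
    Bornology.IsBounded (connectedComponentIn (unitTracePlane \ Γ s₁ s₂ s₃) m))}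

end Polycrystal

end

/-!
The inclusion is proved by relaxation. For `k : ℕ` consider the energy density
`g k B = k dist(B, K(S))³ + |B|³`, which is positively `3`-homogeneous and rotation invariant. Call
`A` attainable if the relaxation of `g k` at `A` stays bounded as `k → ∞`; this set is
`relaxedHull S`. Nearly optimal perturbations of `A x` supported in the unit cube, extended
periodically, are then bounded in `L³`, hence equi-integrable in `L²`, and their gradients approach
`K(S)` in measure, so that `A ∈ K^app(S)` (`mem_Kapp_of_relaxedBound`). Relaxed bounds are stable
under scaling and rotation, and they are convex along rank-one segments
(`RelaxedBound.laminate`, by layers of small thickness inserted with a cutoff function).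
Requiring the perturbations to be uniformly small makes bounds on the fields themselves immediate.

The uniaxial matrices `U = diag(u, u, 1 - 2u)` with `H(u) = 0` are attainable by a self-similar
construction. The equation `H(u) = 0` says that `U - (1 - α) n ⊗ n`, with
`α = u / s₂`, is `α` times a rotated crystal for each of the four vectors
`n = (±√(2u), 0, √(1 - 2u))` and `n = (0, ±√(2u), √(1 - 2u))` (`uniaxial_sub_mem_K`), and these
satisfy `∑ n ⊗ n = 4 U`. Splitting off these four points in turn by a small step leaves a
multiple of `U` itself. Since `α > 2/3`, the volume left decreases faster than the cube of the
multiple increases, so the relaxed energy at `U` satisfies a contractive inequality and is bounded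
uniformly in `k` (`mem_relaxedHull_of_average`).

The rotations `R_α` and `R_β` are chosen so that the rotated `U` is rank-one connected to `α S`;
at a root of `H` the prescribed cosine is `±(1 + s₂ - 4u) / (s₃ - s₁)`, which lies in `[-1, 1]`
because `s₁ + s₂ ≤ 2u ≤ s₂ + s₃`. Hence `M_α(p)` and `M_β(p)` are normalized laminates, and all of
`Γ` is attainable. Finally, multiples of `diag(m)` and `diag(m')` differ by a multiple of
`e₃ ⊗ e₃` when `m` and `m'` lie on a line through `(0, 0, 1)`. Through a point enclosed by `Γ` this
line meets `Γ` on both sides, since otherwise a ray would lie in its bounded component, and the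
point is a normalized laminate of the two points of intersection (`L_subset_attainable`).
-/

noncomputable section

namespace Polycrystal

/-! ### Gradients of smooth fields and relaxed bounds -/

/-- The gradient matrix of a field: `gradMat φ x i k = ∂ φ_i / ∂ x_k`. -/
def gradMat (φ : E3 → E3) (x : E3) : M3 :=
  Matrix.of fun i k => fderiv ℝ φ x (EuclideanSpace.single k 1) i

/-- `RelaxedBound g A t` says that the relaxation (quasiconvex envelope) of the energy density `g`
at `A` is at most `t`: on each bounded open set, affine boundary data `A x` admit an arbitrarily
small `C¹` perturbation with compact support whose energy is at most `t` times the volume, up to an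
arbitrarily small error. -/
def RelaxedBound (g : M3 → ℝ) (A : M3) (t : ℝ) : Prop :=
  0 ≤ t ∧ ∀ Ω : Set E3, IsOpen Ω → Bornology.IsBounded Ω → ∀ ε > 0, ∃ φ : E3 → E3,
    ContDiff ℝ 1 φ ∧ tsupport φ ⊆ Ω ∧ (∀ x, ‖φ x‖ ≤ ε) ∧
      ∫ x in Ω, g (A + gradMat φ x) ≤ t * volume.real Ω + ε

theorem gradMat_eq_of_hasFDerivAt {φ : E3 → E3} {x : E3} {D : E3 →L[ℝ] E3} {M : M3}
    (h : HasFDerivAt φ D x) (hD : ∀ v : E3, D v = WithLp.toLp 2 (M *ᵥ WithLp.ofLp v)) :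
    gradMat φ x = M := by
  ext i k
  simp [gradMat, h.fderiv, hD]

theorem fderiv_eq_gradMat_mulVec (φ : E3 → E3) (x v : E3) :
    fderiv ℝ φ x v = WithLp.toLp 2 (gradMat φ x *ᵥ WithLp.ofLp v) := by
  have hv : v = ∑ k, v k • EuclideanSpace.single k (1 : ℝ) := by
    ext i
    simp [Finset.sum_apply, Pi.single_apply]
  ext i
  conv_lhs => rw [hv]
  simp [gradMat, Matrix.mulVec, dotProduct, mul_comm]

theorem continuous_gradMat {φ : E3 → E3} (h : ContDiff ℝ 1 φ) : Continuous (gradMat φ) := by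
  have h1 := h.continuous_fderiv (by norm_num)
  unfold gradMat
  refine continuous_matrix fun i k => ?_
  simp only [Matrix.of_apply]
  fun_prop

theorem gradMat_eq_zero_of_notMem_tsupport {φ : E3 → E3} {x : E3} (hx : x ∉ tsupport φ) :
    gradMat φ x = 0 := by
  have : fderiv ℝ φ x = 0 := image_eq_zero_of_notMem_tsupport
    (fun h => hx (tsupport_fderiv_subset ℝ h))
  ext i k
  simp [gradMat, this]

theorem gradMat_add {φ ψ : E3 → E3} {x : E3} (hφ : DifferentiableAt ℝ φ x)
    (hψ : DifferentiableAt ℝ ψ x) : gradMat (φ + ψ) x = gradMat φ x + gradMat ψ x := by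
  ext i k
  simp [gradMat, fderiv_add hφ hψ]

theorem gradMat_congr {φ ψ : E3 → E3} {x : E3} (h : φ =ᶠ[𝓝 x] ψ) : gradMat φ x = gradMat ψ x := by
  ext i k
  simp [gradMat, h.fderiv_eq]

/-- The energy density of a compactly supported perturbation is integrable on bounded sets. -/
theorem integrableOn_energy {g : M3 → ℝ} (hg : Continuous g) (A : M3) {φ : E3 → E3}
    (hφ : ContDiff ℝ 1 φ) {Ω : Set E3} (hΩ : Bornology.IsBounded Ω) :
    IntegrableOn (fun x => g (A + gradMat φ x)) Ω := by
  have hc : Continuous fun x => g (A + gradMat φ x) :=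
    hg.comp (continuous_const.add (continuous_gradMat hφ))
  exact (hc.continuousOn.integrableOn_compact hΩ.isCompact_closure).mono_set subset_closure

theorem RelaxedBound.self {g : M3 → ℝ} (A : M3) (hA : 0 ≤ g A) : RelaxedBound g A (g A) := by
  refine ⟨hA, fun Ω _ _ ε hε => ⟨fun _ => 0, contDiff_const, ?_, fun x => by simpa using hε.le, ?_⟩⟩
  · have : tsupport (fun _ : E3 => (0 : E3)) = ∅ := by simp [tsupport]
    simp [this]
  · have : ∀ x, gradMat (fun _ => (0 : E3)) x = 0 := fun x => by ext i k; simp [gradMat]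
    simp only [this, add_zero, setIntegral_const, smul_eq_mul]
    linarith [mul_comm (g A) (volume.real Ω)]

theorem RelaxedBound.mono {g : M3 → ℝ} {A : M3} {t t' : ℝ} (h : RelaxedBound g A t) (ht : t ≤ t') :
    RelaxedBound g A t' := by
  refine ⟨h.1.trans ht, fun Ω ho hb ε hε => ?_⟩
  obtain ⟨φ, h1, h2, h3, h4⟩ := h.2 Ω ho hb ε hε
  exact ⟨φ, h1, h2, h3, h4.trans (by gcongr)⟩

/-- Relaxed bounds are stable under limits in the bound. -/
theorem RelaxedBound.of_forall_pos_add {g : M3 → ℝ} {A : M3} {t : ℝ} (ht : 0 ≤ t)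
    (h : ∀ e > 0, RelaxedBound g A (t + e)) : RelaxedBound g A t := by
  refine ⟨ht, fun Ω ho hb ε hε => ?_⟩
  have hV : 0 ≤ volume.real Ω := measureReal_nonneg
  obtain ⟨φ, h1, h2, h3, h4⟩ :=
    (h (ε / 2 / (volume.real Ω + 1)) (by positivity)).2 Ω ho hb (ε / 2) (by positivity)
  refine ⟨φ, h1, h2, fun x => (h3 x).trans (by linarith), h4.trans ?_⟩
  have : ε / 2 / (volume.real Ω + 1) * volume.real Ω ≤ ε / 2 := by
    rw [div_mul_eq_mul_div, div_le_iff₀ (by positivity)]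
    nlinarith
  nlinarith

/-- For a positively `3`-homogeneous density, scaling the matrix scales the bound by the cube. -/
theorem RelaxedBound.smul {g : M3 → ℝ} (hg : Continuous g)
    (hhom : ∀ (c : ℝ) (B : M3), g (c • B) ≤ |c| ^ 3 * g B)
    {A : M3} {t : ℝ} (h : RelaxedBound g A t) (c : ℝ) : RelaxedBound g (c • A) (|c| ^ 3 * t) := by
  refine ⟨by have := h.1; positivity, fun Ω ho hb ε hε => ?_⟩
  set k : ℝ := |c| ^ 3 + |c| + 1 with hk
  have hk0 : 0 < k := by positivity
  obtain ⟨φ, h1, h2, h3, h4⟩ := h.2 Ω ho hb (ε / k) (by positivity)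
  have hgrad : ∀ x, gradMat (c • φ) x = c • gradMat φ x := fun x => by
    ext i j
    simp [gradMat, fderiv_const_smul (h1.differentiable (by norm_num) x)]
  have hεk : ε / k * k = ε := by field_simp
  have hek : 0 ≤ ε / k := by positivity
  refine ⟨c • φ, contDiff_const.smul h1, ?_, fun x => ?_, ?_⟩
  · refine (closure_mono fun x hx => ?_).trans h2
    simp only [Function.mem_support, Pi.smul_apply] at hx ⊢
    exact fun h0 => hx (by simp [h0])
  · rw [Pi.smul_apply, norm_smul, Real.norm_eq_abs]
    calc |c| * ‖φ x‖ ≤ |c| * (ε / k) := by gcongr; exact h3 x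
      _ ≤ k * (ε / k) := by
        gcongr
        have : 0 ≤ |c| ^ 3 := by positivity
        linarith
      _ = ε := by rw [mul_comm]; exact hεk
  · calc ∫ x in Ω, g (c • A + gradMat (c • φ) x)
        ≤ ∫ x in Ω, |c| ^ 3 * g (A + gradMat φ x) := by
          refine integral_mono (integrableOn_energy hg _ (contDiff_const.smul h1) hb)
            ((integrableOn_energy hg _ h1 hb).const_mul _) fun x => ?_
          simp only [hgrad, ← smul_add]
          exact hhom _ _
      _ = |c| ^ 3 * ∫ x in Ω, g (A + gradMat φ x) := integral_const_mul _ _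
      _ ≤ |c| ^ 3 * (t * volume.real Ω + ε / k) := by gcongr
      _ = |c| ^ 3 * t * volume.real Ω + |c| ^ 3 * (ε / k) := by ring
      _ ≤ |c| ^ 3 * t * volume.real Ω + ε := by
        have : |c| ^ 3 * (ε / k) ≤ k * (ε / k) := by
          gcongr
          have : 0 ≤ |c| := by positivity
          linarith
        linarith [mul_comm k (ε / k)]

/-- The isometry of Euclidean space given by an orthogonal matrix. -/
def orthogonalIsometry (R : M3) (hR : R ∈ Matrix.orthogonalGroup (Fin 3) ℝ) : E3 ≃ₗᵢ[ℝ] E3 :=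
  Unitary.linearIsometryEquiv ⟨Matrix.toEuclideanCLM (𝕜 := ℝ) R, by
    rw [Unitary.mem_iff] at hR ⊢
    rw [← map_star, ← map_mul, ← map_mul, hR.1, hR.2]
    simp⟩

theorem orthogonalIsometry_apply {R : M3} (hR : R ∈ Matrix.orthogonalGroup (Fin 3) ℝ) (x : E3) :
    orthogonalIsometry R hR x = linearField R x := rfl

/-- Relaxed bounds of a rotation invariant density are rotation invariant. -/
theorem RelaxedBound.conj {g : M3 → ℝ}
    {R : M3} (hR : R ∈ Matrix.orthogonalGroup (Fin 3) ℝ)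
    (hinv : ∀ B : M3, g (Rᵀ * B * R) = g B)
    {A : M3} {t : ℝ} (h : RelaxedBound g A t) : RelaxedBound g (Rᵀ * A * R) t := by
  refine ⟨h.1, fun Ω ho hb ε hε => ?_⟩
  set T := orthogonalIsometry R hR with hT
  have hvol : volume.real (T '' Ω) = volume.real Ω := by
    have : T '' Ω = T.symm ⁻¹' Ω := by
      ext y
      simp only [Set.mem_image, Set.mem_preimage]
      exact ⟨by rintro ⟨x, hx, rfl⟩; simpa using hx, fun hy => ⟨_, hy, by simp⟩⟩
    rw [this, measureReal_def, measureReal_def,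
      T.symm.measurePreserving.measure_preimage_emb T.symm.toMeasurableEquiv.measurableEmbedding]
  obtain ⟨φ, h1, h2, h3, h4⟩ := h.2 (T '' Ω) (T.toHomeomorph.isOpenMap _ ho)
    (T.lipschitz.isBounded_image hb) ε hε
  have hgrad : ∀ x, gradMat (T.symm ∘ φ ∘ T) x = Rᵀ * gradMat φ (T x) * R := fun x => by
    have hφ : HasFDerivAt φ (fderiv ℝ φ (T x)) (T x) :=
      (h1.differentiable (by norm_num) _).hasFDerivAt
    have h5 := T.symm.toContinuousLinearEquiv.hasFDerivAt.comp x
      (hφ.comp x T.toContinuousLinearEquiv.hasFDerivAt)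
    refine gradMat_eq_of_hasFDerivAt h5 fun v => ?_
    apply T.injective
    have e1 : T (T.symm (fderiv ℝ φ (T x) (T v))) = fderiv ℝ φ (T x) (T v) := by simp
    refine Eq.trans e1 ?_
    rw [fderiv_eq_gradMat_mulVec]
    have hRR' : R * Rᵀ = 1 := (Matrix.mem_orthogonalGroup_iff (Fin 3) ℝ).1 hR
    simp only [hT, orthogonalIsometry_apply, linearField, Matrix.mulVec_mulVec]
    rw [← Matrix.mul_assoc, ← Matrix.mul_assoc, hRR', Matrix.one_mul]
  refine ⟨T.symm ∘ φ ∘ T, T.symm.contDiff.comp (h1.comp T.contDiff), ?_, fun x => ?_, ?_⟩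
  · have hs : Function.support (T.symm ∘ φ ∘ T) ⊆ T ⁻¹' tsupport φ := fun x hx => by
      refine subset_tsupport _ ?_
      simp only [Function.mem_support, Function.comp_apply] at hx ⊢
      exact fun h0 => hx (by simp [h0])
    have hc : IsClosed (T ⁻¹' tsupport φ) := (isClosed_tsupport φ).preimage T.continuous
    refine (closure_minimal hs hc).trans fun x hx => ?_
    obtain ⟨y, hy, hyx⟩ := h2 hx
    exact T.injective hyx ▸ hy
  · simpa using h3 (T x)
  · calc ∫ x in Ω, g (Rᵀ * A * R + gradMat (T.symm ∘ φ ∘ T) x)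
        = ∫ x in Ω, g (A + gradMat φ (T x)) := by
          refine integral_congr_ae (ae_of_all _ fun x => ?_)
          simp only [hgrad]
          rw [← hinv (A + _), Matrix.mul_add, Matrix.add_mul]
      _ = ∫ y in T '' Ω, g (A + gradMat φ y) := by
          rw [T.measurePreserving.setIntegral_image_emb
            T.toMeasurableEquiv.measurableEmbedding (fun y => g (A + gradMat φ y))]
      _ ≤ _ := by rw [hvol] at h4; exact h4

/-! ### Periodic profiles and averaging over shifts -/

/-- The distance of a real number to the nearest integer. -/
def distInt (t : ℝ) : ℝ := |t - round t|

theorem distInt_le_add (x y : ℝ) : distInt x ≤ distInt y + |x - y| := by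
  have h1 := round_le x (round y)
  have h2 := abs_add_le (y - round y) (x - y)
  unfold distInt
  rw [show y - round y + (x - y) = x - round y by ring] at h2
  linarith

theorem continuous_distInt : Continuous distInt := by
  have : LipschitzWith 1 distInt := LipschitzWith.of_le_add fun x y => by
    simpa [Real.dist_eq] using distInt_le_add x y
  exact this.continuous

theorem periodic_distInt : Function.Periodic distInt 1 := fun t => by
  simp [distInt]

theorem distInt_eq_self {t : ℝ} (h0 : 0 ≤ t) (h1 : t ≤ 1 / 2) : distInt t = t := by
  rw [distInt, abs_sub_round_eq_min, Int.fract_eq_self.2 ⟨h0, by linarith⟩]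
  exact min_eq_left (by linarith)

theorem distInt_eq_one_sub {t : ℝ} (h0 : 1 / 2 ≤ t) (h1 : t ≤ 1) : distInt t = 1 - t := by
  rcases h1.lt_or_eq with h1 | rfl
  · rw [distInt, abs_sub_round_eq_min, Int.fract_eq_self.2 ⟨by linarith, h1⟩]
    exact min_eq_right (by linarith)
  · simp [distInt]

theorem integral_comp_distInt {κ : ℝ → ℝ}
    (h : ∀ a b, IntervalIntegrable (fun t => κ (distInt t)) volume a b) :
    ∫ t in (0 : ℝ)..1, κ (distInt t) = 2 * ∫ t in (0 : ℝ)..(1 / 2), κ t := by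
  rw [← intervalIntegral.integral_add_adjacent_intervals (h 0 (1 / 2)) (h (1 / 2) 1)]
  have e1 : ∫ t in (0 : ℝ)..(1 / 2), κ (distInt t) = ∫ t in (0 : ℝ)..(1 / 2), κ t := by
    refine intervalIntegral.integral_congr fun t ht => ?_
    rw [Set.uIcc_of_le (by norm_num)] at ht
    simp only [distInt_eq_self ht.1 ht.2]
  have e2 : ∫ t in (1 / 2 : ℝ)..1, κ (distInt t) = ∫ t in (1 / 2 : ℝ)..1, κ (1 - t) := by
    refine intervalIntegral.integral_congr fun t ht => ?_
    rw [Set.uIcc_of_le (by norm_num)] at ht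
    simp only [distInt_eq_one_sub ht.1 ht.2]
  rw [e1, e2, intervalIntegral.integral_comp_sub_left]
  norm_num
  ring

/-- Integral over `[0, 1/2]` of a function that is constant before `c₁` and after `c₂`. -/
theorem integral_three_pieces {κ : ℝ → ℝ} {c₁ c₂ v₁ v₃ : ℝ} (h1 : 0 ≤ c₁) (h12 : c₁ ≤ c₂)
    (h2 : c₂ ≤ 1 / 2) (hi : ∀ a ∈ Set.Icc (0 : ℝ) (1 / 2), ∀ b ∈ Set.Icc (0 : ℝ) (1 / 2),
      IntervalIntegrable κ volume a b)
    (hv₁ : ∀ t ∈ Set.Ioo 0 c₁, κ t = v₁) (hv₃ : ∀ t ∈ Set.Ioo c₂ (1 / 2), κ t = v₃) :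
    ∫ t in (0 : ℝ)..(1 / 2), κ t = v₁ * c₁ + (∫ t in c₁..c₂, κ t) + v₃ * (1 / 2 - c₂) := by
  have m0 : (0 : ℝ) ∈ Set.Icc (0 : ℝ) (1 / 2) := by constructor <;> norm_num
  have m1 : c₁ ∈ Set.Icc (0 : ℝ) (1 / 2) := ⟨h1, h12.trans h2⟩
  have m2 : c₂ ∈ Set.Icc (0 : ℝ) (1 / 2) := ⟨h1.trans h12, h2⟩
  have m3 : (1 / 2 : ℝ) ∈ Set.Icc (0 : ℝ) (1 / 2) := by constructor <;> norm_num
  rw [← intervalIntegral.integral_add_adjacent_intervals (hi 0 m0 c₂ m2) (hi c₂ m2 _ m3),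
    ← intervalIntegral.integral_add_adjacent_intervals (hi 0 m0 c₁ m1) (hi c₁ m1 _ m2)]
  have e1 : ∫ t in (0 : ℝ)..c₁, κ t = ∫ _ in (0 : ℝ)..c₁, v₁ := by
    exact intervalIntegral.integral_congr_Ioo_of_le h1 hv₁
  have e3 : ∫ t in c₂..(1 / 2 : ℝ), κ t = ∫ _ in c₂..(1 / 2 : ℝ), v₃ := by
    exact intervalIntegral.integral_congr_Ioo_of_le h2 hv₃
  rw [e1, e3]
  simp only [intervalIntegral.integral_const, smul_eq_mul]
  ring

/-- The integral over a period of a step function of the distance to the integers. -/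
theorem integral_step_distInt {c₁ c₂ v₁ v₂ v₃ : ℝ} (h1 : 0 ≤ c₁) (h12 : c₁ ≤ c₂)
    (h2 : c₂ ≤ 1 / 2) :
    ∫ t in (0 : ℝ)..1, (if distInt t < c₁ then v₁ else if c₂ < distInt t then v₃ else v₂) =
      2 * (v₁ * c₁ + v₂ * (c₂ - c₁) + v₃ * (1 / 2 - c₂)) := by
  set κ : ℝ → ℝ := fun d => if d < c₁ then v₁ else if c₂ < d then v₃ else v₂ with hκ
  have hm : Measurable κ := by
    refine Measurable.ite measurableSet_Iio measurable_const ?_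
    exact Measurable.ite measurableSet_Ioi measurable_const measurable_const
  have hb : ∀ d, ‖κ d‖ ≤ |v₁| + |v₂| + |v₃| := fun d => by
    have := abs_nonneg v₁
    have := abs_nonneg v₂
    have := abs_nonneg v₃
    simp only [hκ, Real.norm_eq_abs]
    split_ifs <;> linarith
  have hint : ∀ k : ℝ → ℝ, Measurable k → ∀ a b,
      IntervalIntegrable (fun t => κ (k t)) volume a b := fun k hk a b => by
    rw [intervalIntegrable_iff]
    exact Measure.integrableOn_of_bounded (by simp [Set.uIoc])
      (hm.comp hk).aestronglyMeasurable (ae_of_all _ fun t => hb _)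
  rw [integral_comp_distInt (κ := κ) (hint _ continuous_distInt.measurable),
    integral_three_pieces (v₁ := v₁) (v₃ := v₃) h1 h12 h2
      ?_ ?_ ?_]
  · have : ∫ t in c₁..c₂, κ t = ∫ _ in c₁..c₂, v₂ := by
      refine intervalIntegral.integral_congr fun t ht => ?_
      rw [Set.uIcc_of_le h12] at ht
      simp [hκ, not_lt.2 ht.1, not_lt.2 ht.2]
    rw [this]
    simp only [intervalIntegral.integral_const, smul_eq_mul]
    ring
  · exact fun a _ b _ => hint id measurable_id a b
  · exact fun t ht => by simp [hκ, ht.2]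
  · exact fun t ht => by simp [hκ, ht.1, not_lt.2 (h12.trans ht.1.le)]

/-- A bounded `C¹` sawtooth profile: up to a transition layer of total length `2η` per period, the
slope is `1 - p` on a fraction `p` of the line and `-p` elsewhere. -/
theorem exists_sawtooth {p η : ℝ} (hη : 0 < η) (hp : η ≤ p) (hp' : η ≤ 1 - p) :
    ∃ s : ℝ → ℝ, ContDiff ℝ 1 s ∧ (∃ M, ∀ t, |s t| ≤ M) ∧ (∀ t, |deriv s t| ≤ 1) ∧
      (∀ t, distInt t < (p - η) / 2 → deriv s t = 1 - p) ∧
      (∀ t, (p + η) / 2 < distInt t → deriv s t = -p) := by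
  set θ : ℝ → ℝ := fun d => max 0 (min 1 (((p + η) / 2 - d) / η)) with hθ
  have hθc : Continuous θ := by fun_prop
  set f : ℝ → ℝ := fun t => θ (distInt t) - p with hf
  have hfc : Continuous f := (hθc.comp continuous_distInt).sub continuous_const
  have hfp : Function.Periodic f 1 := fun t => by simp [hf, periodic_distInt t]
  have hθ1 : ∀ d ≤ (p - η) / 2, θ d = 1 := fun d hd => by
    have : 1 ≤ ((p + η) / 2 - d) / η := by rw [le_div_iff₀ hη]; linarith
    simp [hθ, this]
  have hθ0 : ∀ d ≥ (p + η) / 2, θ d = 0 := fun d hd => by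
    have : ((p + η) / 2 - d) / η ≤ 0 := div_nonpos_of_nonpos_of_nonneg (by linarith) hη.le
    simp [hθ, this]
  have hmean : ∫ t in (0 : ℝ)..1, f t = 0 := by
    have e : ∫ t in (0 : ℝ)..1, f t = (∫ t in (0 : ℝ)..1, θ (distInt t)) - p := by
      have h := intervalIntegral.integral_sub (μ := volume) (a := 0) (b := 1)
        (f := fun t => θ (distInt t)) (g := fun _ => p)
        ((hθc.comp continuous_distInt).intervalIntegrable _ _) (by simp)
      refine h.trans ?_
      simp
    have em : ∫ t in ((p - η) / 2)..((p + η) / 2), θ t = η / 2 := by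
      have : ∫ t in ((p - η) / 2)..((p + η) / 2), θ t =
          ∫ t in ((p - η) / 2)..((p + η) / 2), ((p + η) / 2 - t) / η := by
        refine intervalIntegral.integral_congr fun t ht => ?_
        rw [Set.uIcc_of_le (by linarith)] at ht
        have h1 : ((p + η) / 2 - t) / η ≤ 1 := by
          rw [div_le_iff₀ hη]; linarith [ht.1]
        have h2 : 0 ≤ ((p + η) / 2 - t) / η := div_nonneg (by linarith [ht.2]) hη.le
        simp [hθ, h1, h2]
      rw [this, intervalIntegral.integral_div, intervalIntegral.integral_sub (by simp) (by simp)]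
      simp only [intervalIntegral.integral_const, smul_eq_mul, integral_id]
      field_simp
      ring
    rw [e, integral_comp_distInt fun a b =>
        (hθc.comp continuous_distInt).intervalIntegrable _ _,
      integral_three_pieces (c₁ := (p - η) / 2) (c₂ := (p + η) / 2) (v₁ := 1) (v₃ := 0)
        (by linarith) (by linarith) (by linarith)
        (fun a _ b _ => hθc.intervalIntegrable _ _) (fun t ht => hθ1 t ht.2.le)
        (fun t ht => hθ0 t ht.1.le), em]
    ring
  set s : ℝ → ℝ := fun x => ∫ t in (0 : ℝ)..x, f t with hs
  have hsd : ∀ x, HasDerivAt s (f x) x := fun x =>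
    intervalIntegral.integral_hasDerivAt_right (hfc.intervalIntegrable _ _)
      (hfc.stronglyMeasurableAtFilter _ _) hfc.continuousAt
  have hds : deriv s = f := funext fun x => (hsd x).deriv
  have hsc : ContDiff ℝ 1 s := by
    rw [contDiff_one_iff_deriv]
    exact ⟨fun x => (hsd x).differentiableAt, hds ▸ hfc⟩
  have hsp : Function.Periodic s 1 := fun x => by
    have h1 := hfp.intervalIntegral_add_eq x 0
    simp only [zero_add] at h1
    rw [hs]
    simp only
    rw [← intervalIntegral.integral_add_adjacent_intervals (b := x)
      (hfc.intervalIntegrable _ _) (hfc.intervalIntegrable _ _), h1, hmean, add_zero]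
  refine ⟨s, hsc, ?_, fun t => ?_, fun t ht => ?_, fun t ht => ?_⟩
  · obtain ⟨M, hM⟩ := (hsp.isBounded_of_continuous one_ne_zero hsc.continuous).exists_norm_le
    exact ⟨M, fun t => hM _ ⟨t, rfl⟩⟩
  · have h1 : 0 ≤ θ (distInt t) := le_max_left _ _
    have h2 : θ (distInt t) ≤ 1 := max_le zero_le_one (min_le_left _ _)
    rw [hds, hf, abs_le]
    constructor <;> simp only <;> linarith
  · rw [hds, hf]; simp only; rw [hθ1 _ ht.le]
  · rw [hds, hf]; simp only; rw [hθ0 _ ht.le]; ring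

/-- Averaging over the phase: some shift of a periodic function of a scalar field has spatial
integral at most its mean value times the volume. -/
theorem exists_shift_setIntegral_le {k : ℝ → ℝ} (hk : Measurable k) (hper : Function.Periodic k 1)
    {C : ℝ} (hC : ∀ t, ‖k t‖ ≤ C) {Ω : Set E3} (hΩ : volume Ω ≠ ⊤) {ℓ : E3 → ℝ}
    (hℓ : Measurable ℓ) :
    ∃ τ : ℝ, ∫ x in Ω, k (ℓ x + τ) ≤ volume.real Ω * ∫ t in (0 : ℝ)..1, k t := by
  have : IsFiniteMeasure (volume.restrict Ω) := isFiniteMeasure_restrict.2 hΩ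
  have hF : Integrable (Function.uncurry fun (τ : ℝ) (x : E3) => k (ℓ x + τ))
      ((volume.restrict (Set.Ioc (0 : ℝ) 1)).prod (volume.restrict Ω)) := by
    refine Integrable.of_bound (C := C) ?_ (ae_of_all _ fun z => hC _)
    exact (hk.comp ((hℓ.comp measurable_snd).add measurable_fst)).aestronglyMeasurable
  obtain ⟨τ, -, hτ⟩ := exists_le_setAverage (μ := volume) (s := Set.Ioc (0 : ℝ) 1)
    (f := fun τ => ∫ x in Ω, k (ℓ x + τ)) (by simp) (by simp) hF.integral_prod_left
  refine ⟨τ, hτ.trans (le_of_eq ?_)⟩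
  rw [setAverage_eq, integral_integral_swap hF]
  have : ∀ x, ∫ τ in Set.Ioc (0 : ℝ) 1, k (ℓ x + τ) = ∫ t in (0 : ℝ)..1, k t := fun x => by
    rw [← intervalIntegral.integral_of_le zero_le_one,
      intervalIntegral.integral_comp_add_left (fun t => k t), add_zero,
      hper.intervalIntegral_add_eq (ℓ x) 0, zero_add]
  simp [this]

/-! ### Lamination -/

theorem gradMat_smul_const {q : E3 → ℝ} {x : E3} (hq : DifferentiableAt ℝ q x) (a : Fin 3 → ℝ) :
    gradMat (fun y => q y • (WithLp.toLp 2 a : E3)) x =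
      Matrix.vecMulVec a (fun k => fderiv ℝ q x (EuclideanSpace.single k 1)) := by
  ext i k
  have : fderiv ℝ (fun y => q y • (WithLp.toLp 2 a : E3)) x =
      (fderiv ℝ q x).smulRight (WithLp.toLp 2 a : E3) :=
    (hq.hasFDerivAt.smul_const (WithLp.toLp 2 a : E3)).fderiv
  simp [gradMat, this, Matrix.vecMulVec_apply, mul_comm]

/-- A bounded open set carries a `C¹` cutoff function that equals one on an open subset of almost
full measure. -/
theorem exists_cutoff {Ω : Set E3} (ho : IsOpen Ω) (hb : Bornology.IsBounded Ω) {ε : ℝ}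
    (hε : 0 < ε) : ∃ (U : Set E3) (χ : E3 → ℝ), IsOpen U ∧ U ⊆ Ω ∧ volume.real (Ω \ U) ≤ ε ∧
      ContDiff ℝ 1 χ ∧ tsupport χ ⊆ Ω ∧ (∀ x, 0 ≤ χ x ∧ χ x ≤ 1) ∧ ∀ x ∈ U, χ x = 1 := by
  have hfin : volume Ω ≠ ⊤ := hb.measure_lt_top.ne
  obtain ⟨Q, hQΩ, hQ, hQv⟩ := ho.measurableSet.exists_isCompact_sdiff_lt hfin
    (ENNReal.ofReal_pos.2 hε).ne'
  obtain ⟨U, hU, hQU, hUΩ, hUc⟩ := exists_open_between_and_isCompact_closure hQ ho hQΩ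
  obtain ⟨V, hV, hUV, hVΩ, -⟩ := exists_open_between_and_isCompact_closure hUc ho hUΩ
  obtain ⟨χ, hχ, hχr, hχs, hχ1⟩ := exists_contMDiff_support_eq_eq_one_iff (n := 1)
    (modelWithCornersSelf ℝ E3) hV isClosed_closure hUV
  refine ⟨U, χ, hU, subset_closure.trans hUΩ, ?_, contMDiff_iff_contDiff.1 hχ, ?_,
    fun x => hχr ⟨x, rfl⟩, fun x hx => (hχ1 x).1 (subset_closure hx)⟩
  · refine ENNReal.toReal_le_of_le_ofReal hε.le (le_trans (measure_mono ?_) hQv.le)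
    exact Set.sdiff_subset_sdiff_right hQU
  · rw [tsupport, hχs]
    exact hVΩ

theorem setIntegral_eq_add_add_diff {F : E3 → ℝ} {Ω S T : Set E3} (hF : IntegrableOn F Ω)
    (hS : MeasurableSet S) (hT : MeasurableSet T) (hd : Disjoint S T) (hSΩ : S ⊆ Ω) (hTΩ : T ⊆ Ω) :
    ∫ x in Ω, F x = (∫ x in S, F x) + (∫ x in T, F x) + ∫ x in Ω \ (S ∪ T), F x := by
  rw [← setIntegral_union hd hT (hF.mono_set hSΩ) (hF.mono_set hTΩ),
    ← integral_inter_add_sdiff (hS.union hT) hF,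
    Set.inter_eq_self_of_subset_right (Set.union_subset hSΩ hTΩ)]

/-- A simple laminate: a small compactly supported field whose gradient equals `(1 - p) a ⊗ n` on an
open set `B` and `-p a ⊗ n` on an open set `C`, where up to a small error `B` and `C` fill the
fractions `p` and `1 - p` of the domain. The volume fractions are recorded through the weighted
sum with the given weights `tB`, `tC`, `M`. -/
theorem exists_simple_laminate {a n : Fin 3 → ℝ} {p tB tC M : ℝ} (hp : 0 < p) (hp1 : p < 1)
    (htB : 0 ≤ tB) (htC : 0 ≤ tC) (hM : 0 ≤ M) {Ω : Set E3} (ho : IsOpen Ω)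
    (hb : Bornology.IsBounded Ω) {ε : ℝ} (hε : 0 < ε) :
    ∃ (φ : E3 → E3) (B C : Set E3), ContDiff ℝ 1 φ ∧ tsupport φ ⊆ Ω ∧ (∀ x, ‖φ x‖ ≤ ε) ∧
      (∀ x, ‖gradMat φ x‖ ≤ ‖Matrix.vecMulVec a n‖ + 1) ∧
      IsOpen B ∧ IsOpen C ∧ Disjoint B C ∧ B ⊆ Ω ∧ C ⊆ Ω ∧
      (∀ x ∈ B, gradMat φ x = (1 - p) • Matrix.vecMulVec a n) ∧
      (∀ x ∈ C, gradMat φ x = (-p) • Matrix.vecMulVec a n) ∧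
      tB * volume.real B + tC * volume.real C + M * volume.real (Ω \ (B ∪ C)) ≤
        (p * tB + (1 - p) * tC) * volume.real Ω + ε := by
  have hfin : volume Ω ≠ ⊤ := hb.measure_lt_top.ne
  set V := volume.real Ω with hV
  have hV0 : 0 ≤ V := measureReal_nonneg
  set η := min (min p (1 - p)) (ε / (4 * (M * V + 1))) with hη
  have hMV : 0 ≤ M * V := by positivity
  have hη0 : 0 < η := by
    refine lt_min (lt_min hp (by linarith)) (by positivity)
  have hηp : η ≤ p := (min_le_left _ _).trans (min_le_left _ _)
  have hηp' : η ≤ 1 - p := (min_le_left _ _).trans (min_le_right _ _)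
  have hηε : η * (M * V) ≤ ε / 4 := by
    have h1 : η ≤ ε / (4 * (M * V + 1)) := min_le_right _ _
    rw [le_div_iff₀ (by positivity)] at h1
    nlinarith
  obtain ⟨s, hs, ⟨S, hS⟩, hs1, hsB, hsC⟩ := exists_sawtooth hη0 hηp hηp'
  obtain ⟨U, χ, hUo, hUΩ, hUv, hχ, hχs, hχ01, hχ1⟩ :=
    exists_cutoff ho hb (ε := ε / (2 * (M + 1))) (by positivity)
  have hS0 : 0 ≤ S := (abs_nonneg _).trans (hS 0)
  -- a bound for the contribution of the gradient of the cutoff function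
  set w : E3 → Fin 3 → ℝ := fun x k => fderiv ℝ χ x (EuclideanSpace.single k 1) with hw
  have hwc : Continuous w := by
    have := hχ.continuous_fderiv (by norm_num)
    fun_prop
  have hχcomp : HasCompactSupport χ :=
    hb.isCompact_closure.of_isClosed_subset (isClosed_tsupport χ) (hχs.trans subset_closure)
  obtain ⟨Λ, hΛ⟩ : ∃ Λ, ∀ x, ‖Matrix.vecMulVec a (w x)‖ ≤ Λ := by
    refine Continuous.bounded_above_of_compact_support (f := fun x => Matrix.vecMulVec a (w x))
      ?_ ?_
    · exact continuous_const.matrix_vecMulVec hwc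
    · refine HasCompactSupport.intro hχcomp fun x hx => ?_
      have : fderiv ℝ χ x = 0 := image_eq_zero_of_notMem_tsupport
        fun h => hx (tsupport_fderiv_subset ℝ h)
      ext i k
      simp [hw, this, Matrix.vecMulVec_apply]
  have hΛ0 : 0 ≤ Λ := (norm_nonneg _).trans (hΛ 0)
  set na : ℝ := ‖(WithLp.toLp 2 a : E3)‖ with hna
  have hna0 : 0 ≤ na := norm_nonneg _
  -- the layer thickness
  obtain ⟨h, hh0, hhε, hhΛ⟩ : ∃ h : ℝ, 0 < h ∧ h * S * na ≤ ε ∧ h * S * Λ ≤ 1 := by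
    refine ⟨min (ε / (S * na + 1)) (1 / (S * Λ + 1)), by positivity, ?_, ?_⟩
    · have h1 : min (ε / (S * na + 1)) (1 / (S * Λ + 1)) ≤ ε / (S * na + 1) := min_le_left _ _
      rw [le_div_iff₀ (by positivity)] at h1
      have : 0 < min (ε / (S * na + 1)) (1 / (S * Λ + 1)) := by positivity
      nlinarith
    · have h1 : min (ε / (S * na + 1)) (1 / (S * Λ + 1)) ≤ 1 / (S * Λ + 1) := min_le_right _ _
      rw [le_div_iff₀ (by positivity)] at h1
      have : 0 < min (ε / (S * na + 1)) (1 / (S * Λ + 1)) := by positivity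
      nlinarith
  set ℓ : E3 →L[ℝ] ℝ := h⁻¹ • innerSL ℝ (WithLp.toLp 2 n : E3) with hℓ
  -- the phase shift
  set k : ℝ → ℝ := fun t =>
    if distInt t < (p - η) / 2 then tB else if (p + η) / 2 < distInt t then tC else M with hk
  have hkm : Measurable k := by
    refine Measurable.ite (measurableSet_lt continuous_distInt.measurable measurable_const)
      measurable_const (Measurable.ite
        (measurableSet_lt measurable_const continuous_distInt.measurable)
        measurable_const measurable_const)
  have hkC : ∀ t, ‖k t‖ ≤ tB + tC + M := fun t => by
    simp only [hk, Real.norm_eq_abs]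
    split_ifs
    · rw [abs_of_nonneg htB]; linarith
    · rw [abs_of_nonneg htC]; linarith
    · rw [abs_of_nonneg hM]; linarith
  have hkint : ∫ t in (0 : ℝ)..1, k t ≤ p * tB + (1 - p) * tC + 2 * η * M := by
    rw [hk, integral_step_distInt (by linarith) (by linarith) (by linarith)]
    nlinarith
  have hkp : Function.Periodic k 1 := fun t => by simp only [hk, periodic_distInt t]
  have hUfin : volume U ≠ ⊤ := (measure_mono hUΩ).trans_lt hfin.lt_top |>.ne
  obtain ⟨τ, hτ⟩ := exists_shift_setIntegral_le hkm hkp hkC hUfin ℓ.continuous.measurable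
  have hpc : Continuous fun x => distInt (ℓ x + τ) :=
    continuous_distInt.comp (ℓ.continuous.add continuous_const)
  set B : Set E3 := U ∩ {x | distInt (ℓ x + τ) < (p - η) / 2} with hB
  set C : Set E3 := U ∩ {x | (p + η) / 2 < distInt (ℓ x + τ)} with hC
  have hBo : IsOpen B := hUo.inter (isOpen_lt hpc continuous_const)
  have hCo : IsOpen C := hUo.inter (isOpen_lt continuous_const hpc)
  have hdisj : Disjoint B C := Set.disjoint_left.2 fun x hx hx' => by
    have h1 := hx.2
    have h2 := hx'.2
    simp only [Set.mem_ofPred_eq] at h1 h2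
    linarith
  set q : E3 → ℝ := fun x => χ x * (h * s (ℓ x + τ)) with hq
  have hqd : ContDiff ℝ 1 q :=
    hχ.mul (contDiff_const.mul (hs.comp (ℓ.contDiff.add contDiff_const)))
  have hgrad : ∀ x, gradMat (fun y => q y • (WithLp.toLp 2 a : E3)) x =
      (χ x * deriv s (ℓ x + τ)) • Matrix.vecMulVec a n +
        (h * s (ℓ x + τ)) • Matrix.vecMulVec a (w x) := fun x => by
    rw [gradMat_smul_const (hqd.differentiable (by norm_num) x)]
    have d1 : HasFDerivAt χ (fderiv ℝ χ x) x :=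
      (hχ.differentiable (by norm_num) x).hasFDerivAt
    have d2 : HasFDerivAt (fun y => ℓ y + τ) ℓ x := ℓ.hasFDerivAt.add_const τ
    have d3 : HasDerivAt s (deriv s (ℓ x + τ)) (ℓ x + τ) :=
      (hs.differentiable (by norm_num) _).hasDerivAt
    have d4 := d1.mul ((d3.comp_hasFDerivAt x d2).const_mul h)
    ext i j
    have d5 : fderiv ℝ q x = _ := d4.fderiv
    rw [Matrix.vecMulVec_apply, d5]
    simp [hℓ, hw, Matrix.vecMulVec_apply, EuclideanSpace.inner_single_right]
    field_simp
  have hgradU : ∀ x ∈ U, gradMat (fun y => q y • (WithLp.toLp 2 a : E3)) x =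
      deriv s (ℓ x + τ) • Matrix.vecMulVec a n := fun x hx => by
    have hwx : w x = 0 := by
      have : χ =ᶠ[𝓝 x] fun _ => 1 := by
        filter_upwards [hUo.mem_nhds hx] with y hy using hχ1 y hy
      ext k
      simp [hw, this.fderiv_eq]
    rw [hgrad, hwx, hχ1 x hx]
    simp
  have hsupp : tsupport (fun y => q y • (WithLp.toLp 2 a : E3)) ⊆ Ω := by
    refine (closure_mono fun x hx => ?_).trans hχs
    simp only [Function.mem_support] at hx ⊢
    exact fun h0 => hx (by simp [hq, h0])
  have hχabs : ∀ x, |χ x| ≤ 1 := fun x => by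
    rw [abs_of_nonneg (hχ01 x).1]; exact (hχ01 x).2
  refine ⟨fun y => q y • (WithLp.toLp 2 a : E3), B, C, hqd.smul contDiff_const, hsupp,
    fun x => ?_, fun x => ?_, hBo, hCo, hdisj, Set.inter_subset_left.trans hUΩ,
    Set.inter_subset_left.trans hUΩ, fun x hx => ?_, fun x hx => ?_, ?_⟩
  · rw [norm_smul, Real.norm_eq_abs, hq]
    simp only [abs_mul, abs_of_pos hh0]
    calc |χ x| * (h * |s (ℓ x + τ)|) * na ≤ 1 * (h * S) * na := by
          gcongr
          · exact hχabs x
          · exact hS _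
      _ ≤ ε := by linarith
  · rw [hgrad]
    refine (norm_add_le _ _).trans ?_
    rw [norm_smul, norm_smul, Real.norm_eq_abs, Real.norm_eq_abs]
    simp only [abs_mul, abs_of_pos hh0]
    refine add_le_add ?_ ?_
    · calc |χ x| * |deriv s (ℓ x + τ)| * ‖Matrix.vecMulVec a n‖
          ≤ 1 * 1 * ‖Matrix.vecMulVec a n‖ := by
            gcongr
            · exact hχabs x
            · exact hs1 _
        _ = _ := by ring
    · calc h * |s (ℓ x + τ)| * ‖Matrix.vecMulVec a (w x)‖ ≤ h * S * Λ := by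
            gcongr
            · exact hS _
            · exact hΛ x
        _ ≤ 1 := hhΛ
  · rw [hgradU x hx.1, hsB _ hx.2]
  · rw [hgradU x hx.1, hsC _ hx.2]
  · have hkU : IntegrableOn (fun x => k (ℓ x + τ)) U :=
      Measure.integrableOn_of_bounded hUfin
        (hkm.comp (ℓ.continuous.measurable.add_const τ)).aestronglyMeasurable
        (ae_of_all _ fun x => hkC _)
    rw [setIntegral_eq_add_add_diff hkU hBo.measurableSet hCo.measurableSet hdisj
      Set.inter_subset_left Set.inter_subset_left] at hτ
    have i1 : ∫ x in B, k (ℓ x + τ) = tB * volume.real B := by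
      rw [setIntegral_congr_fun (g := fun _ => tB) hBo.measurableSet fun x hx => ?_]
      · simp [mul_comm]
      · exact if_pos hx.2
    have i2 : ∫ x in C, k (ℓ x + τ) = tC * volume.real C := by
      rw [setIntegral_congr_fun (g := fun _ => tC) hCo.measurableSet fun x hx => ?_]
      · simp [mul_comm]
      · have h2 := hx.2
        simp only [Set.mem_ofPred_eq] at h2
        have h1 : ¬ distInt (ℓ x + τ) < (p - η) / 2 := by linarith
        simp only [hk, if_neg h1, if_pos h2]
    have i3 : ∫ x in U \ (B ∪ C), k (ℓ x + τ) = M * volume.real (U \ (B ∪ C)) := by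
      rw [setIntegral_congr_fun (g := fun _ => M)
        (hUo.measurableSet.diff (hBo.measurableSet.union hCo.measurableSet)) fun x hx => ?_]
      · simp [mul_comm]
      · have h1 : ¬ distInt (ℓ x + τ) < (p - η) / 2 := fun h' => hx.2 (Or.inl ⟨hx.1, h'⟩)
        have h2 : ¬ (p + η) / 2 < distInt (ℓ x + τ) := fun h' => hx.2 (Or.inr ⟨hx.1, h'⟩)
        simp only [hk, if_neg h1, if_neg h2]
    rw [i1, i2, i3] at hτ
    have hrest : volume.real (Ω \ (B ∪ C)) ≤
        volume.real (Ω \ U) + volume.real (U \ (B ∪ C)) := by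
      refine (measureReal_mono ?_ ?_).trans (measureReal_union_le _ _)
      · intro x hx
        by_cases hxU : x ∈ U
        · exact Or.inr ⟨hxU, hx.2⟩
        · exact Or.inl ⟨hx.1, hxU⟩
      · exact ((measure_mono (Set.union_subset Set.sdiff_subset
          (Set.sdiff_subset.trans hUΩ))).trans_lt hfin.lt_top).ne
    have hU1 : volume.real U ≤ V := measureReal_mono hUΩ hfin
    have hU0 : 0 ≤ volume.real U := measureReal_nonneg
    have hMU : M * volume.real (Ω \ U) ≤ ε / 2 := by
      rw [le_div_iff₀ (by positivity)] at hUv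
      have : 0 ≤ volume.real (Ω \ U) := measureReal_nonneg
      nlinarith
    have hJ : volume.real U * ∫ t in (0 : ℝ)..1, k t ≤
        (p * tB + (1 - p) * tC) * V + ε / 2 := by
      have hp1' : 0 ≤ 1 - p := by linarith
      calc volume.real U * ∫ t in (0 : ℝ)..1, k t
          ≤ volume.real U * (p * tB + (1 - p) * tC + 2 * η * M) := by gcongr
        _ ≤ V * (p * tB + (1 - p) * tC + 2 * η * M) := by gcongr
        _ = (p * tB + (1 - p) * tC) * V + 2 * (η * (M * V)) := by ring
        _ ≤ _ := by linarith
    have := mul_le_mul_of_nonneg_left hrest hM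
    linarith

/-- The relaxation of an energy density is convex along rank-one segments. -/
theorem RelaxedBound.laminate {g : M3 → ℝ} (hg : Continuous g) (hg0 : ∀ B, 0 ≤ g B) {B C : M3}
    {a n : Fin 3 → ℝ} (hBC : B - C = Matrix.vecMulVec a n) {tB tC : ℝ} (hB : RelaxedBound g B tB)
    (hC : RelaxedBound g C tC) {p : ℝ} (hp : p ∈ Set.Icc (0 : ℝ) 1) :
    RelaxedBound g (p • B + (1 - p) • C) (p * tB + (1 - p) * tC) := by
  rcases hp.1.eq_or_lt with rfl | hp0
  · simpa using hC
  rcases hp.2.eq_or_lt with rfl | hp1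
  · simpa using hB
  have hq0 : 0 < 1 - p := by linarith
  have htB := hB.1
  have htC := hC.1
  refine ⟨by positivity, fun Ω ho hb ε hε => ?_⟩
  set A : M3 := p • B + (1 - p) • C with hA
  have hAB : A + (1 - p) • Matrix.vecMulVec a n = B := by
    rw [hA, ← hBC]; module
  have hAC : A + (-p) • Matrix.vecMulVec a n = C := by
    rw [hA, ← hBC]; module
  obtain ⟨M, hM⟩ : ∃ M, ∀ X : M3, ‖X‖ ≤ ‖A‖ + (‖Matrix.vecMulVec a n‖ + 1) → g X ≤ M := by
    obtain ⟨M, hM⟩ := (isCompact_closedBall (0 : M3)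
      (‖A‖ + (‖Matrix.vecMulVec a n‖ + 1))).exists_bound_of_continuousOn hg.continuousOn
    exact ⟨M, fun X hX => (le_abs_self _).trans (hM X (by simpa using hX))⟩
  have hM0 : 0 ≤ M := (hg0 0).trans (hM 0 (by rw [norm_zero]; positivity))
  obtain ⟨φ, ΩB, ΩC, hφ, hφs, hφε, hφM, hBo, hCo, hd, hBΩ, hCΩ, hgB, hgC, hvol⟩ :=
    exists_simple_laminate (a := a) (n := n) hp0 hp1 htB htC hM0 ho hb (ε := ε / 3) (by positivity)
  obtain ⟨φB, hφB, hφBs, hφBε, hEB⟩ := hB.2 ΩB hBo (hb.subset hBΩ) (ε / 3) (by positivity)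
  obtain ⟨φC, hφC, hφCs, hφCε, hEC⟩ := hC.2 ΩC hCo (hb.subset hCΩ) (ε / 3) (by positivity)
  have hψ : ContDiff ℝ 1 (φ + φB + φC) := (hφ.add hφB).add hφC
  have hgrad : ∀ x, gradMat (φ + φB + φC) x = gradMat φ x + gradMat φB x + gradMat φC x :=
    fun x => by
      rw [gradMat_add (φ := φ + φB) (((hφ.add hφB).differentiable (by norm_num)) x)
        (hφC.differentiable (by norm_num) x), gradMat_add (hφ.differentiable (by norm_num) x)
        (hφB.differentiable (by norm_num) x)]
  have hB0 : ∀ x ∉ ΩB, gradMat φB x = 0 := fun x hx =>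
    gradMat_eq_zero_of_notMem_tsupport fun h => hx (hφBs h)
  have hC0 : ∀ x ∉ ΩC, gradMat φC x = 0 := fun x hx =>
    gradMat_eq_zero_of_notMem_tsupport fun h => hx (hφCs h)
  refine ⟨φ + φB + φC, hψ, ?_, fun x => ?_, ?_⟩
  · refine closure_minimal ?_ (((isClosed_tsupport φ).union
      (isClosed_tsupport φB)).union (isClosed_tsupport φC)) |>.trans
      (Set.union_subset (Set.union_subset hφs (hφBs.trans hBΩ)) (hφCs.trans hCΩ))
    intro x hx
    by_contra hcon
    simp only [Set.mem_union, not_or] at hcon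
    refine hx ?_
    simp [image_eq_zero_of_notMem_tsupport hcon.1.1, image_eq_zero_of_notMem_tsupport hcon.1.2,
      image_eq_zero_of_notMem_tsupport hcon.2]
  · calc ‖(φ + φB + φC) x‖ ≤ ‖φ x‖ + ‖φB x‖ + ‖φC x‖ := norm_add₃_le
      _ ≤ ε := by linarith [hφε x, hφBε x, hφCε x]
  · rw [setIntegral_eq_add_add_diff (integrableOn_energy hg A hψ hb) hBo.measurableSet
      hCo.measurableSet hd hBΩ hCΩ]
    have i1 : ∫ x in ΩB, g (A + gradMat (φ + φB + φC) x) = ∫ x in ΩB, g (B + gradMat φB x) := by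
      refine setIntegral_congr_fun hBo.measurableSet fun x hx => ?_
      rw [hgrad, hgB x hx, hC0 x (Set.disjoint_left.1 hd hx), add_zero, ← add_assoc, hAB]
    have i2 : ∫ x in ΩC, g (A + gradMat (φ + φB + φC) x) = ∫ x in ΩC, g (C + gradMat φC x) := by
      refine setIntegral_congr_fun hCo.measurableSet fun x hx => ?_
      rw [hgrad, hgC x hx, hB0 x (Set.disjoint_right.1 hd hx), add_zero, ← add_assoc, hAC]
    have i3 : ∫ x in Ω \ (ΩB ∪ ΩC), g (A + gradMat (φ + φB + φC) x) ≤
        M * volume.real (Ω \ (ΩB ∪ ΩC)) := by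
      have hfin : volume (Ω \ (ΩB ∪ ΩC)) ≠ ⊤ := (hb.subset Set.sdiff_subset).measure_lt_top.ne
      calc ∫ x in Ω \ (ΩB ∪ ΩC), g (A + gradMat (φ + φB + φC) x)
          ≤ ∫ x in Ω \ (ΩB ∪ ΩC), M := by
            refine setIntegral_mono_on ((integrableOn_energy hg A hψ hb).mono_set Set.sdiff_subset)
              (integrableOn_const hfin) (ho.measurableSet.diff
                (hBo.measurableSet.union hCo.measurableSet)) fun x hx => hM _ ?_
            rw [hgrad, hB0 x fun h => hx.2 (Or.inl h), hC0 x fun h => hx.2 (Or.inr h), add_zero,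
              add_zero]
            exact (norm_add_le _ _).trans (by linarith [hφM x])
        _ = _ := by simp [mul_comm]
    rw [i1, i2]
    linarith

/-! ### Periodic extension -/

/-- The open unit cube. -/
def unitCube : Set E3 := {x | ∀ i, x i ∈ Set.Ioo (0 : ℝ) 1}

/-- The lattice point below `x`. -/
def latticeFloor (x : E3) : E3 := WithLp.toLp 2 fun i => (⌊x i⌋ : ℝ)

/-- The representative of `x` modulo the integer lattice in the half-open unit cube. -/
def fracPart (x : E3) : E3 := x - latticeFloor x

theorem fracPart_apply (x : E3) (i : Fin 3) : fracPart x i = Int.fract (x i) := rfl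

theorem fracPart_add_single (x : E3) (i : Fin 3) :
    fracPart (x + EuclideanSpace.single i 1) = fracPart x := by
  ext j
  simp only [fracPart_apply, PiLp.add_apply]
  by_cases h : j = i
  · subst h; simp
  · simp [h]

theorem isOpen_unitCube : IsOpen unitCube := by
  have : unitCube = ⋂ i : Fin 3, {x : E3 | x i ∈ Set.Ioo (0 : ℝ) 1} := by
    ext x; simp [unitCube]
  rw [this]
  exact isOpen_iInter_of_finite fun i =>
    isOpen_Ioo.preimage (by fun_prop : Continuous fun x : E3 => x i)

theorem isBounded_unitCube : Bornology.IsBounded unitCube := by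
  refine (Metric.isBounded_iff_subset_closedBall 0).2 ⟨√3, fun x hx => ?_⟩
  rw [mem_closedBall_zero_iff, EuclideanSpace.norm_eq]
  refine Real.sqrt_le_sqrt ?_
  calc ∑ i, ‖x i‖ ^ 2 ≤ ∑ _i : Fin 3, (1 : ℝ) := by
        refine Finset.sum_le_sum fun i _ => ?_
        have h := hx i
        rw [Real.norm_of_nonneg h.1.le]
        nlinarith [h.1, h.2]
    _ = 3 := by simp

/-- Locally, the periodic extension of a function supported in the open unit cube is a lattice
translate of that function. -/
theorem comp_fracPart_eventuallyEq {V : Type*} [Zero V] {F : E3 → V} (hF : tsupport F ⊆ unitCube)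
    (x : E3) : (fun y => F (fracPart y)) =ᶠ[𝓝 x] fun y => F (y - latticeFloor x) := by
  by_cases hx : fracPart x ∈ unitCube
  · have h : ∀ i, ∀ᶠ y : E3 in 𝓝 x, ⌊y i⌋ = ⌊x i⌋ := fun i => by
      have hc : Continuous fun y : E3 => y i := by fun_prop
      have h1 := hx i
      rw [fracPart_apply, Int.fract] at h1
      have : Set.Ioo (⌊x i⌋ : ℝ) (⌊x i⌋ + 1) ∈ 𝓝 (x i) :=
        Ioo_mem_nhds (by linarith [h1.1]) (by linarith [h1.2])
      filter_upwards [hc.continuousAt.preimage_mem_nhds this] with y hy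
      exact Int.floor_eq_iff.2 ⟨hy.1.le, hy.2⟩
    filter_upwards [eventually_all.2 h] with y hy
    have : latticeFloor y = latticeFloor x := by ext i; simp [latticeFloor, hy i]
    rw [fracPart, this]
  · obtain ⟨i, hi⟩ : ∃ i, Int.fract (x i) = 0 := by
      by_contra! hcon
      exact hx fun i => ⟨(Int.fract_nonneg _).lt_of_ne' (hcon i), Int.fract_lt_one _⟩
    have hc : Continuous fun y : E3 => y i := by fun_prop
    have hcomp : IsCompact (tsupport F) := isBounded_unitCube.isCompact_closure.of_isClosed_subset
      (isClosed_tsupport F) (hF.trans subset_closure)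
    have hZ : IsClosed ((fun y : E3 => y i) '' tsupport F) := (hcomp.image hc).isClosed
    have hF0 : ∀ z : E3, z i ∉ (fun y : E3 => y i) '' tsupport F → F z = 0 := fun z hz =>
      image_eq_zero_of_notMem_tsupport fun h => hz ⟨z, h, rfl⟩
    have h0 : ((fun y : E3 => y i) '' tsupport F)ᶜ ∈ 𝓝 (x i - ⌊x i⌋) := by
      refine hZ.isOpen_compl.mem_nhds ?_
      rintro ⟨y, hy, hyi⟩
      have h1 := (hF hy i).1
      simp only at hyi
      rw [hyi] at h1
      exact h1.ne' hi
    have h1 : ((fun y : E3 => y i) '' tsupport F)ᶜ ∈ 𝓝 (x i - ⌊x i⌋ + 1) := by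
      refine hZ.isOpen_compl.mem_nhds ?_
      rintro ⟨y, hy, hyi⟩
      have h1 := (hF hy i).2
      simp only at hyi
      rw [Int.fract] at hi
      rw [hyi, hi] at h1
      linarith
    have hxi : x i = ⌊x i⌋ := by rw [Int.fract] at hi; linarith
    have h2 : Set.Ioo ((⌊x i⌋ : ℝ) - 1) (⌊x i⌋ + 1) ∈ 𝓝 (x i) :=
      Ioo_mem_nhds (by linarith) (by linarith)
    have c0 : ContinuousAt (fun y : E3 => y i - ⌊x i⌋) x := by fun_prop
    have c1 : ContinuousAt (fun y : E3 => y i - ⌊x i⌋ + 1) x := by fun_prop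
    filter_upwards [c0.preimage_mem_nhds h0, c1.preimage_mem_nhds h1,
      hc.continuousAt.preimage_mem_nhds h2] with y hy0 hy1 hy2
    rw [hF0 (y - latticeFloor x) hy0]
    refine hF0 _ ?_
    rw [fracPart_apply, Int.fract]
    rcases le_or_gt (⌊x i⌋ : ℝ) (y i) with h | h
    · rw [(Int.floor_eq_iff (z := ⌊x i⌋)).2 ⟨h, hy2.2⟩]
      exact hy0
    · have : ⌊y i⌋ = ⌊x i⌋ - 1 := by
        rw [Int.floor_eq_iff]
        push_cast
        exact ⟨hy2.1.le, by linarith⟩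
      rw [this]
      push_cast
      rw [← sub_add]
      exact hy1

theorem contDiff_comp_fracPart {φ : E3 → E3} (hφ : ContDiff ℝ 1 φ) (hs : tsupport φ ⊆ unitCube) :
    ContDiff ℝ 1 fun x => φ (fracPart x) := by
  rw [contDiff_iff_contDiffAt]
  intro x
  refine ContDiffAt.congr_of_eventuallyEq ?_ (comp_fracPart_eventuallyEq hs x)
  exact (hφ.comp (contDiff_id.sub contDiff_const)).contDiffAt

theorem gradMat_comp_fracPart {φ : E3 → E3} (hs : tsupport φ ⊆ unitCube) (x : E3) :
    gradMat (fun y => φ (fracPart y)) x = gradMat φ (fracPart x) := by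
  rw [gradMat_congr (comp_fracPart_eventuallyEq hs x)]
  ext i k
  simp [gradMat, fderiv_comp_sub, fracPart]

theorem measurable_latticeFloor : Measurable latticeFloor := by
  unfold latticeFloor
  refine (WithLp.measurable_toLp _ _).comp (measurable_pi_lambda _ fun i => ?_)
  have : Measurable fun x : E3 => x i := (by fun_prop : Continuous fun x : E3 => x i).measurable
  fun_prop

theorem latticeFloor_preimage_zero_ae_eq : latticeFloor ⁻¹' {0} =ᵐ[volume] unitCube := by
  have h1 : latticeFloor ⁻¹' {0} =
      WithLp.ofLp ⁻¹' (Set.univ.pi fun _ : Fin 3 => Set.Ico (0 : ℝ) 1) := by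
    ext x
    simp only [Set.mem_preimage, Set.mem_singleton_iff, latticeFloor, Set.mem_univ_pi]
    rw [WithLp.toLp_eq_zero, funext_iff]
    refine forall_congr' fun i => ?_
    simp [Int.floor_eq_zero_iff]
  have h2 : unitCube = WithLp.ofLp ⁻¹' (Set.univ.pi fun _ : Fin 3 => Set.Ioo (0 : ℝ) 1) := by
    ext x
    simp [unitCube]
  rw [h1, h2]
  exact (PiLp.volume_preserving_ofLp (Fin 3)).quasiMeasurePreserving.preimage_ae_eq
    (Measure.univ_pi_Ico_ae_eq_Icc.trans Measure.univ_pi_Ioo_ae_eq_Icc.symm)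

/-- Integrals over a compact set of periodic functions are controlled by the integral over the
unit cube. -/
theorem exists_setLIntegral_comp_fracPart_le {Q : Set E3} (hQ : IsCompact Q) :
    ∃ N : ℕ, ∀ G : E3 → ℝ≥0∞, Measurable G →
      ∫⁻ x in Q, G (fracPart x) ≤ N * ∫⁻ x in unitCube, G x := by
  have hfin : (latticeFloor '' Q).Finite := by
    obtain ⟨ρ, hρ⟩ := hQ.isBounded.exists_norm_le
    have hsub : latticeFloor '' Q ⊆
        (fun z : Fin 3 → ℤ => (WithLp.toLp 2 fun i => (z i : ℝ) : E3)) ''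
        (Set.univ.pi fun _ => Set.Icc ⌊-ρ⌋ ⌊ρ⌋) := by
      rintro _ ⟨x, hx, rfl⟩
      refine ⟨fun i => ⌊x i⌋, fun i _ => ?_, rfl⟩
      have h1 : |x i| ≤ ρ := (PiLp.norm_apply_le x i).trans (hρ x hx)
      exact ⟨Int.floor_mono (abs_le.1 h1).1, Int.floor_mono (abs_le.1 h1).2⟩
    exact ((Set.Finite.pi fun _ => Set.finite_Icc _ _).image _).subset hsub
  have := hfin.fintype
  refine ⟨Fintype.card (latticeFloor '' Q), fun G hG => ?_⟩
  have hcell : ∀ z ∈ latticeFloor '' Q,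
      ∫⁻ x in latticeFloor ⁻¹' {z}, G (fracPart x) = ∫⁻ x in unitCube, G x := by
    rintro _ ⟨y, -, rfl⟩
    rw [← setLIntegral_congr latticeFloor_preimage_zero_ae_eq,
      ← (measurePreserving_sub_right volume (latticeFloor y)).setLIntegral_comp_preimage
        (measurable_latticeFloor (measurableSet_singleton 0)) hG]
    have hset : (fun x => x - latticeFloor y) ⁻¹' (latticeFloor ⁻¹' {0}) =
        latticeFloor ⁻¹' {latticeFloor y} := by
      ext x
      simp only [Set.mem_preimage, Set.mem_singleton_iff]
      have : latticeFloor (x - latticeFloor y) = latticeFloor x - latticeFloor y := by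
        ext i
        simp [latticeFloor]
      rw [this, sub_eq_zero]
    rw [hset]
    refine setLIntegral_congr_fun (measurable_latticeFloor (measurableSet_singleton _))
      fun x hx => ?_
    rw [Set.mem_preimage, Set.mem_singleton_iff] at hx
    rw [fracPart, hx]
  calc ∫⁻ x in Q, G (fracPart x)
      ≤ ∫⁻ x in ⋃ z : latticeFloor '' Q, latticeFloor ⁻¹' {(z : E3)}, G (fracPart x) := by
        refine lintegral_mono_set fun x hx => ?_
        exact Set.mem_iUnion.2 ⟨⟨_, x, hx, rfl⟩, rfl⟩
    _ ≤ ∑' z : latticeFloor '' Q, ∫⁻ x in latticeFloor ⁻¹' {(z : E3)}, G (fracPart x) :=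
        lintegral_iUnion_le _ _
    _ = ∑' _z : latticeFloor '' Q, ∫⁻ x in unitCube, G x :=
        tsum_congr fun z => hcell _ z.2
    _ = _ := by rw [tsum_fintype]; simp

/-! ### Approximate solutions from relaxed bounds -/

theorem memLp_of_continuous_of_isCompact {V : Type*} [NormedAddCommGroup V] {f : E3 → V}
    (hf : Continuous f) {Q : Set E3} (hQ : IsCompact Q) (p : ℝ≥0∞) :
    MemLp f p (volume.restrict Q) := by
  have : IsFiniteMeasure (volume.restrict Q) := isFiniteMeasure_restrict.2 hQ.measure_lt_top.ne
  obtain ⟨c, hc⟩ := hQ.exists_bound_of_continuousOn hf.continuousOn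
  exact MemLp.of_bound hf.aestronglyMeasurable c
    ((ae_restrict_iff' hQ.measurableSet).2 (ae_of_all _ hc))

theorem aestronglyMeasurable_of_continuous {V : Type*} [NormedAddCommGroup V] {f : E3 → V}
    (hf : Continuous f) (μ : Measure E3) : AEStronglyMeasurable f μ :=
  hf.aestronglyMeasurable

theorem eLpNorm_two_le_eLpNorm_three {V : Type*} [NormedAddCommGroup V] {f : E3 → V}
    {μ : Measure E3} (hf : AEStronglyMeasurable f μ) :
    eLpNorm f 2 μ ≤ eLpNorm f 3 μ * μ Set.univ ^ (1 / 6 : ℝ) := by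
  have h := eLpNorm_le_eLpNorm_mul_rpow_measure_univ (p := 2) (q := 3) (by norm_num) hf
  have hexp : (1 / (2 : ℝ≥0∞).toReal - 1 / (3 : ℝ≥0∞).toReal) = 1 / 6 := by norm_num
  rwa [hexp] at h

theorem hasWeakGradient_of_contDiff {u : E3 → E3} (hu : ContDiff ℝ 1 u) :
    HasWeakGradient u (gradMat u) where
  memLp Q hQ := memLp_of_continuous_of_isCompact hu.continuous hQ 2
  memLp_grad Q hQ := memLp_of_continuous_of_isCompact (continuous_gradMat hu) hQ 2
  integral_eq φ hφ hφc i k := by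
    have hui : ContDiff ℝ 1 fun x => u x i := by fun_prop
    have hφ1 : ContDiff ℝ 1 φ := hφ.of_le (by exact_mod_cast le_top)
    have hfd : ∀ x, fderiv ℝ (fun y => u y i) x (EuclideanSpace.single k 1) = gradMat u x i k :=
      fun x => by
        have h := (EuclideanSpace.proj (𝕜 := ℝ) i).hasFDerivAt.comp x
          (hu.differentiable (by norm_num) x).hasFDerivAt
        have h' : HasFDerivAt (fun y => u y i)
          ((EuclideanSpace.proj (𝕜 := ℝ) i).comp (fderiv ℝ u x)) x := h
        rw [h'.fderiv]
        rfl
    have cg : Continuous fun x => gradMat u x i k :=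
      (continuous_gradMat hu).matrix_elem i k
    have cφ : Continuous fun x => fderiv ℝ φ x (EuclideanSpace.single k 1) := by
      have := hφ1.continuous_fderiv (by norm_num)
      fun_prop
    rw [integral_mul_fderiv_eq_neg_fderiv_mul_of_integrable (f := fun x => u x i)]
    · simp only [hfd]
    · simp only [hfd]
      exact (cg.mul hφ.continuous).integrable_of_hasCompactSupport hφc.mul_left
    · exact (hui.continuous.mul cφ).integrable_of_hasCompactSupport
        ((hφc.fderiv_apply (𝕜 := ℝ) _).mul_left)
    · exact (hui.continuous.mul hφ.continuous).integrable_of_hasCompactSupport hφc.mul_left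
    · exact fun x _ => hui.differentiable (by norm_num) x
    · exact fun x _ => hφ1.differentiable (by norm_num) x

theorem contDiff_linearField (A : M3) : ContDiff ℝ 1 (linearField A) :=
  (Matrix.toEuclideanCLM (𝕜 := ℝ) A).contDiff

theorem gradMat_linearField (A : M3) (x : E3) : gradMat (linearField A) x = A :=
  gradMat_eq_of_hasFDerivAt (Matrix.toEuclideanCLM (𝕜 := ℝ) A).hasFDerivAt fun _ => rfl

/-- The penalized energy density `k dist(B, K(S))³ + |B|³`. The cubic growth gives
equi-integrability in `L²` of gradients with bounded energy. -/
def energyDensity (S : M3) (k : ℕ) (B : M3) : ℝ := k * Metric.infDist B (K S) ^ 3 + ‖B‖ ^ 3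

theorem energyDensity_nonneg (S : M3) (k : ℕ) (B : M3) : 0 ≤ energyDensity S k B := by
  have : 0 ≤ Metric.infDist B (K S) := Metric.infDist_nonneg
  unfold energyDensity
  positivity

theorem continuous_energyDensity (S : M3) (k : ℕ) : Continuous (energyDensity S k) := by
  unfold energyDensity
  have : Continuous fun B : M3 => Metric.infDist B (K S) := Metric.continuous_infDist_pt _
  have : Continuous fun B : M3 => ‖B‖ := continuous_norm
  fun_prop

theorem eLpNorm_three_le {V : Type*} [NormedAddCommGroup V] {μ : Measure E3} {f : E3 → V}
    {c : ℝ≥0∞} (h : ∫⁻ x, ENNReal.ofReal (‖f x‖ ^ 3) ∂μ ≤ c) :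
    eLpNorm f 3 μ ≤ c ^ (1 / 3 : ℝ) := by
  rw [eLpNorm_eq_lintegral_rpow_enorm_toReal (by norm_num) (by norm_num)]
  simp only [ENNReal.toReal_ofNat]
  refine ENNReal.rpow_le_rpow (le_trans (le_of_eq (lintegral_congr fun x => ?_)) h) (by norm_num)
  rw [ENNReal.ofReal_pow (norm_nonneg _), ofReal_norm]
  exact_mod_cast ENNReal.rpow_natCast _ 3

/-- A family bounded in `L³` on a finite measure space is equi-integrable in `L²`. -/
theorem unifIntegrable_two_of_eLpNorm_three_le {ι V : Type*} [NormedAddCommGroup V]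
    {μ : Measure E3} {f : ι → E3 → V} (hf : ∀ i, AEStronglyMeasurable (f i) μ) {c : ℝ≥0}
    (h : ∀ i, eLpNorm (f i) 3 μ ≤ c) : UnifIntegrable f 2 μ := by
  intro ε hε
  refine ⟨(ε / (c + 1)) ^ 6, by positivity, fun i s hs hμs => ?_⟩
  rw [eLpNorm_indicator_eq_eLpNorm_restrict hs]
  have h1 := eLpNorm_two_le_eLpNorm_three (hf i).restrict (μ := μ.restrict s)
  rw [Measure.restrict_apply_univ] at h1
  have h2 : eLpNorm (f i) 3 (μ.restrict s) ≤ c :=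
    (eLpNorm_mono_measure _ Measure.restrict_le_self).trans (h i)
  have h3 : μ s ^ (1 / 6 : ℝ) ≤ ENNReal.ofReal (ε / (c + 1)) := by
    refine (ENNReal.rpow_le_rpow hμs (by norm_num)).trans (le_of_eq ?_)
    rw [ENNReal.ofReal_rpow_of_nonneg (by positivity) (by norm_num), ← Real.rpow_natCast,
      ← Real.rpow_mul (by positivity)]
    norm_num
  calc eLpNorm (f i) 2 (μ.restrict s) ≤ c * ENNReal.ofReal (ε / (c + 1)) :=
        h1.trans (mul_le_mul' h2 h3)
    _ = ENNReal.ofReal (c * (ε / (c + 1))) := by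
        rw [ENNReal.ofReal_mul (by positivity), ENNReal.ofReal_coe_nnreal]
    _ ≤ ENNReal.ofReal ε := by
        refine ENNReal.ofReal_le_ofReal ?_
        rw [mul_div_assoc', div_le_iff₀ (by positivity)]
        nlinarith [c.2]

/-- If the relaxed penalized energies at a symmetric matrix stay bounded as the penalty grows, then
the matrix is an average field of approximate solutions: perturbations of `A x` supported in the
unit cube with nearly optimal energy are extended periodically. -/
theorem mem_Kapp_of_relaxedBound {S A : M3} (hA : A.IsSymm) {M : ℝ}
    (h : ∀ k : ℕ, RelaxedBound (energyDensity S k) A M) : A ∈ Kapp S := by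
  refine ⟨hA, ?_⟩
  -- the penalty `k + 1` is positive, so that dividing by it is harmless
  choose φ hφ hφs hφ1 hφE using fun k : ℕ =>
    (h (k + 1)).2 unitCube isOpen_unitCube isBounded_unitCube 1 one_pos
  set M' : ℝ := M * volume.real unitCube + 1 with hM'
  have hM'0 : 0 ≤ M' := by have := (h 0).1; positivity
  set ψ : ℕ → E3 → E3 := fun k x => φ k (fracPart x) with hψ
  have hψc : ∀ k, ContDiff ℝ 1 (ψ k) := fun k => contDiff_comp_fracPart (hφ k) (hφs k)
  have hu : ∀ k, ContDiff ℝ 1 (linearField A + ψ k) := fun k => (contDiff_linearField A).add (hψc k)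
  have hgrad : ∀ k x, gradMat (linearField A + ψ k) x = A + gradMat (φ k) (fracPart x) :=
    fun k x => by
      rw [gradMat_add ((contDiff_linearField A).differentiable (by norm_num) x)
        ((hψc k).differentiable (by norm_num) x), gradMat_linearField,
        gradMat_comp_fracPart (hφs k)]
  have hgc : ∀ k, Continuous fun x => A + gradMat (φ k) x := fun k =>
    continuous_const.add (continuous_gradMat (hφ k))
  have hDc : ∀ k, Continuous (gradMat (linearField A + ψ k)) := fun k => continuous_gradMat (hu k)
  have hdist : Continuous fun B : M3 => Metric.infDist B (K S) := Metric.continuous_infDist_pt _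
  -- energy bounds over the unit cube
  have hmeas : ∀ (F : M3 → ℝ), Continuous F → ∀ k,
      Measurable fun x => ENNReal.ofReal (F (A + gradMat (φ k) x)) := fun F hF k =>
    ENNReal.measurable_ofReal.comp (hF.comp (hgc k)).measurable
  have hcube : ∀ (F : M3 → ℝ), Continuous F → (∀ B, 0 ≤ F B) → ∀ (k : ℕ) (c : ℝ),
      (∀ B, c * F B ≤ energyDensity S (k + 1) B) → 0 < c →
      ∫⁻ x in unitCube, ENNReal.ofReal (F (A + gradMat (φ k) x)) ≤ ENNReal.ofReal (M' / c) := by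
    intro F hF hF0 k c hc hc0
    rw [← ofReal_integral_eq_lintegral_ofReal
      (integrableOn_energy hF A (hφ k) isBounded_unitCube) (ae_of_all _ fun x => hF0 _)]
    refine ENNReal.ofReal_le_ofReal ?_
    rw [le_div_iff₀ hc0, mul_comm, ← integral_const_mul]
    refine le_trans (integral_mono ((integrableOn_energy hF A (hφ k)
      isBounded_unitCube).const_mul c) (integrableOn_energy (continuous_energyDensity S (k + 1)) A
      (hφ k) isBounded_unitCube) fun x => hc _) (hφE k)
  have hnorm : ∀ k, ∫⁻ x in unitCube, ENNReal.ofReal (‖A + gradMat (φ k) x‖ ^ 3) ≤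
      ENNReal.ofReal M' := fun k => by
    have := hcube (fun B => ‖B‖ ^ 3) (by fun_prop) (fun B => by positivity) k 1 (fun B => by
      have : 0 ≤ Metric.infDist B (K S) := Metric.infDist_nonneg
      have : 0 ≤ ((k + 1 : ℕ) : ℝ) * Metric.infDist B (K S) ^ 3 := by positivity
      unfold energyDensity
      linarith) one_pos
    simpa using this
  have hdistE : ∀ k : ℕ, ∫⁻ x in unitCube,
      ENNReal.ofReal (Metric.infDist (A + gradMat (φ k) x) (K S) ^ 3) ≤
      ENNReal.ofReal (M' / (k + 1 : ℝ)) := fun k => by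
    refine hcube (fun B => Metric.infDist B (K S) ^ 3) (by fun_prop) (fun B => ?_) k (k + 1)
      (fun B => ?_) (by positivity)
    · have : 0 ≤ Metric.infDist B (K S) := Metric.infDist_nonneg
      positivity
    · have : 0 ≤ ‖B‖ ^ 3 := by positivity
      unfold energyDensity
      push_cast
      linarith
  -- energy bounds over compact sets
  have hQ3 : ∀ Q : Set E3, IsCompact Q → ∃ c : ℝ≥0, ∀ k,
      eLpNorm (gradMat (linearField A + ψ k)) 3 (volume.restrict Q) ≤ c := fun Q hQ => by
    obtain ⟨N, hN⟩ := exists_setLIntegral_comp_fracPart_le hQ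
    refine ⟨((N : ℝ≥0) * M'.toNNReal) ^ (1 / 3 : ℝ), fun k => ?_⟩
    rw [ENNReal.coe_rpow_of_nonneg _ (by norm_num)]
    refine eLpNorm_three_le ?_
    simp only [hgrad]
    refine (hN _ (hmeas (fun B => ‖B‖ ^ 3) (by fun_prop) k)).trans ?_
    push_cast
    gcongr
    exact hnorm k
  refine ⟨fun k => linearField A + ψ k, fun k => gradMat (linearField A + ψ k),
    fun k => hasWeakGradient_of_contDiff (hu k), fun k => ?_, fun Q hQ => ?_, fun Q hQ => ?_,
    fun Q hQ => ?_⟩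
  · have : (fun x => (linearField A + ψ k) x - linearField A x) = ψ k := by
      ext1 x
      simp
    simp only [this]
    exact ⟨⟨_, hasWeakGradient_of_contDiff (hψc k)⟩, fun i => ae_of_all _ fun x => by
      simp only [hψ, fracPart_add_single]⟩
  · have : IsFiniteMeasure (volume.restrict Q) := isFiniteMeasure_restrict.2 hQ.measure_lt_top.ne
    obtain ⟨c, hc⟩ := hQ3 Q hQ
    obtain ⟨b, hb⟩ := hQ.exists_bound_of_continuousOn
      (contDiff_linearField A).continuous.continuousOn
    set c₁ : ℝ≥0∞ := volume.restrict Q Set.univ ^ (2 : ℝ≥0∞).toReal⁻¹ * ENNReal.ofReal (b + 1)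
    set c₂ : ℝ≥0∞ := c * volume.restrict Q Set.univ ^ (1 / 6 : ℝ)
    have hc₁ : c₁ ≠ ⊤ := ENNReal.mul_ne_top
      (ENNReal.rpow_ne_top_of_nonneg (by positivity) (measure_ne_top _ _)) ENNReal.ofReal_ne_top
    have hc₂ : c₂ ≠ ⊤ := ENNReal.mul_ne_top ENNReal.coe_ne_top
      (ENNReal.rpow_ne_top_of_nonneg (by norm_num) (measure_ne_top _ _))
    refine ⟨(max c₁ c₂).toNNReal, fun k => ?_⟩
    rw [ENNReal.coe_toNNReal (by simp [hc₁, hc₂])]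
    constructor
    · refine (eLpNorm_le_of_ae_bound ((ae_restrict_iff' hQ.measurableSet).2
        (ae_of_all _ fun x hx => ?_))).trans (le_max_left _ _)
      exact (norm_add_le _ _).trans (add_le_add (hb x hx) (hφ1 k _))
    · refine (eLpNorm_two_le_eLpNorm_three
        (aestronglyMeasurable_of_continuous (hDc k) _)).trans (le_trans ?_ (le_max_right _ _))
      exact mul_le_mul' (hc k) le_rfl
  · obtain ⟨c, hc⟩ := hQ3 Q hQ
    exact unifIntegrable_two_of_eLpNorm_three_le 
      (fun k => aestronglyMeasurable_of_continuous (hDc k) _) hc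
  · obtain ⟨N, hN⟩ := exists_setLIntegral_comp_fracPart_le hQ
    refine tendstoInMeasure_of_tendsto_eLpNorm (p := 3) (by norm_num)
      (fun k => (hdist.comp (hDc k)).aestronglyMeasurable) aestronglyMeasurable_const ?_
    have hlim : Tendsto
        (fun k : ℕ => ((N : ℝ≥0∞) * ENNReal.ofReal (M' / (k + 1 : ℝ))) ^ (1 / 3 : ℝ))
        atTop (𝓝 0) := by
      have h1 : Tendsto (fun k : ℕ => M' / (k + 1 : ℝ)) atTop (𝓝 0) :=
by
        simpa [div_eq_mul_inv] using (tendsto_one_div_add_atTop_nhds_zero_nat (𝕜 := ℝ)).const_mul M'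
      have h2 := ENNReal.tendsto_ofReal h1
      have h3 := ENNReal.Tendsto.const_mul (a := (N : ℝ≥0∞)) h2 (Or.inr (ENNReal.natCast_ne_top N))
      simpa using h3.ennrpow_const (1 / 3)
    refine tendsto_of_tendsto_of_tendsto_of_le_of_le tendsto_const_nhds hlim (fun _ => zero_le)
      fun k => eLpNorm_three_le ?_
    have hd : ∀ x, ‖Metric.infDist (gradMat (linearField A + ψ k) x) (K S) - (0 : ℝ)‖ ^ 3 =
        Metric.infDist (A + gradMat (φ k) (fracPart x)) (K S) ^ 3 :=
      fun x => by
        rw [sub_zero, hgrad, Real.norm_of_nonneg Metric.infDist_nonneg]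
    simp only [Pi.sub_apply, hd]
    refine (hN _ (hmeas (fun B => Metric.infDist B (K S) ^ 3) (by fun_prop) k)).trans ?_
    gcongr
    exact hdistE k

/-! ### The hull of attainable matrices -/

/-- The matrices at which the relaxed penalized energies stay bounded as the penalty grows. -/
def relaxedHull (S : M3) : Set M3 :=
  {A | ∃ M : ℝ, ∀ k : ℕ, RelaxedBound (energyDensity S k) A M}

theorem smul_mem_K {S B : M3} (hB : B ∈ K S) (c : ℝ) : c • B ∈ K S := by
  obtain ⟨d, R, hR, rfl⟩ := hB
  exact ⟨c * d, R, hR, by rw [smul_smul]⟩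

theorem conj_mem_K {S B : M3} (hB : B ∈ K S) {R : M3}
    (hR : R ∈ Matrix.specialOrthogonalGroup (Fin 3) ℝ) : Rᵀ * B * R ∈ K S := by
  obtain ⟨d, P, hP, rfl⟩ := hB
  refine ⟨d, P * R, mul_mem hP hR, ?_⟩
  simp only [Matrix.transpose_mul, Matrix.mul_smul, Matrix.smul_mul, Matrix.mul_assoc]

theorem zero_mem_K (S : M3) : (0 : M3) ∈ K S := ⟨0, 1, one_mem _, by simp⟩

theorem transpose_mem_specialOrthogonalGroup {R : M3}
    (hR : R ∈ Matrix.specialOrthogonalGroup (Fin 3) ℝ) :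
    Rᵀ ∈ Matrix.specialOrthogonalGroup (Fin 3) ℝ := by
  rw [Matrix.mem_specialOrthogonalGroup_iff, Matrix.mem_orthogonalGroup_iff] at hR ⊢
  refine ⟨?_, by rw [Matrix.det_transpose]; exact hR.2⟩
  rw [Matrix.transpose_transpose]
  exact mul_eq_one_comm.1 hR.1

theorem mul_transpose_of_mem_specialOrthogonalGroup {R : M3}
    (hR : R ∈ Matrix.specialOrthogonalGroup (Fin 3) ℝ) : R * Rᵀ = 1 :=
  (Matrix.mem_orthogonalGroup_iff (Fin 3) ℝ).1 (Matrix.mem_specialOrthogonalGroup_iff.1 hR).1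

theorem transpose_mul_of_mem_specialOrthogonalGroup {R : M3}
    (hR : R ∈ Matrix.specialOrthogonalGroup (Fin 3) ℝ) : Rᵀ * R = 1 :=
  mul_eq_one_comm.1 (mul_transpose_of_mem_specialOrthogonalGroup hR)

theorem norm_sq_eq_trace (A : M3) : ‖A‖ ^ 2 = (Aᵀ * A).trace := by
  rw [Matrix.frobenius_norm_def, ← Real.rpow_natCast, ← Real.rpow_mul (by positivity)]
  simp [Matrix.trace, Matrix.mul_apply, Fin.sum_univ_three, pow_two]
  ring

theorem norm_conj {R : M3} (hR : R ∈ Matrix.specialOrthogonalGroup (Fin 3) ℝ) (B : M3) :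
    ‖Rᵀ * B * R‖ = ‖B‖ := by
  have h := mul_transpose_of_mem_specialOrthogonalGroup hR
  have : ‖Rᵀ * B * R‖ ^ 2 = ‖B‖ ^ 2 := by
    rw [norm_sq_eq_trace, norm_sq_eq_trace]
    have e : (Rᵀ * B * R)ᵀ * (Rᵀ * B * R) = Rᵀ * (Bᵀ * (R * Rᵀ) * B * R) := by
      simp only [Matrix.transpose_mul, Matrix.transpose_transpose, Matrix.mul_assoc]
    rw [e, h, Matrix.mul_one, Matrix.trace_mul_comm, Matrix.mul_assoc, h, Matrix.mul_one]
  exact (pow_left_inj₀ (norm_nonneg _) (norm_nonneg _) two_ne_zero).1 this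

theorem infDist_smul_le (S : M3) (c : ℝ) (B : M3) :
    Metric.infDist (c • B) (K S) ≤ |c| * Metric.infDist B (K S) := by
  refine le_of_forall_pos_le_add fun ε hε => ?_
  obtain ⟨y, hy, hyd⟩ := (Metric.infDist_lt_iff ⟨0, zero_mem_K S⟩ (x := B)
    (r := Metric.infDist B (K S) + ε / (|c| + 1))).1 (by linarith [div_pos hε (by positivity :
      0 < |c| + 1)])
  refine (Metric.infDist_le_dist_of_mem (smul_mem_K hy c)).trans ?_
  rw [dist_eq_norm, ← smul_sub, norm_smul, ← dist_eq_norm, Real.norm_eq_abs]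
  calc |c| * dist B y ≤ |c| * (Metric.infDist B (K S) + ε / (|c| + 1)) := by gcongr
    _ = |c| * Metric.infDist B (K S) + |c| * (ε / (|c| + 1)) := by ring
    _ ≤ |c| * Metric.infDist B (K S) + ε := by
      gcongr
      rw [mul_div_assoc', div_le_iff₀ (by positivity)]
      nlinarith [abs_nonneg c]

theorem infDist_conj_le (S : M3) {R : M3} (hR : R ∈ Matrix.specialOrthogonalGroup (Fin 3) ℝ)
    (B : M3) : Metric.infDist (Rᵀ * B * R) (K S) ≤ Metric.infDist B (K S) := by
  refine le_of_forall_gt fun r hr => ?_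
  obtain ⟨y, hy, hyd⟩ := (Metric.infDist_lt_iff ⟨0, zero_mem_K S⟩).1 hr
  refine (Metric.infDist_le_dist_of_mem (conj_mem_K hy hR)).trans_lt ?_
  rwa [dist_eq_norm, ← Matrix.sub_mul, ← Matrix.mul_sub, norm_conj hR, ← dist_eq_norm]

theorem energyDensity_smul_le (S : M3) (k : ℕ) (c : ℝ) (B : M3) :
    energyDensity S k (c • B) ≤ |c| ^ 3 * energyDensity S k B := by
  have h := infDist_smul_le S c B
  have h0 : 0 ≤ Metric.infDist (c • B) (K S) := Metric.infDist_nonneg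
  unfold energyDensity
  rw [norm_smul, Real.norm_eq_abs]
  calc (k : ℝ) * Metric.infDist (c • B) (K S) ^ 3 + (|c| * ‖B‖) ^ 3
      ≤ k * (|c| * Metric.infDist B (K S)) ^ 3 + (|c| * ‖B‖) ^ 3 := by gcongr
    _ = _ := by ring

theorem energyDensity_conj (S : M3) (k : ℕ) {R : M3}
    (hR : R ∈ Matrix.specialOrthogonalGroup (Fin 3) ℝ) (B : M3) :
    energyDensity S k (Rᵀ * B * R) = energyDensity S k B := by
  have h1 := infDist_conj_le S hR B
  have h2 := infDist_conj_le S (transpose_mem_specialOrthogonalGroup hR) (Rᵀ * B * R)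
  have e : Rᵀᵀ * (Rᵀ * B * R) * Rᵀ = B := by
    have h := mul_transpose_of_mem_specialOrthogonalGroup hR
    rw [Matrix.transpose_transpose]
    calc R * (Rᵀ * B * R) * Rᵀ = (R * Rᵀ) * B * (R * Rᵀ) := by simp only [Matrix.mul_assoc]
      _ = B := by rw [h, Matrix.one_mul, Matrix.mul_one]
  rw [e] at h2
  rw [energyDensity, energyDensity, norm_conj hR, le_antisymm h1 h2]

theorem energyDensity_le_of_mem_K {S B : M3} (hB : B ∈ K S) (k : ℕ) (X : M3) :
    energyDensity S k (B + X) ≤ k * ‖X‖ ^ 3 + (‖B‖ + ‖X‖) ^ 3 := by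
  have h1 : Metric.infDist (B + X) (K S) ≤ ‖X‖ := by
    simpa [dist_eq_norm] using Metric.infDist_le_dist_of_mem hB (x := B + X)
  have h0 : 0 ≤ Metric.infDist (B + X) (K S) := Metric.infDist_nonneg
  unfold energyDensity
  gcongr
  exact norm_add_le _ _

theorem mem_relaxedHull_of_mem_K {S B : M3} (hB : B ∈ K S) : B ∈ relaxedHull S :=
  ⟨‖B‖ ^ 3, fun k => (RelaxedBound.self B (energyDensity_nonneg S k B)).mono (by
    simpa using energyDensity_le_of_mem_K hB k 0)⟩

theorem smul_mem_relaxedHull {S A : M3} (hA : A ∈ relaxedHull S) (c : ℝ) :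
    c • A ∈ relaxedHull S := by
  obtain ⟨M, hM⟩ := hA
  exact ⟨|c| ^ 3 * M, fun k =>
    (hM k).smul (continuous_energyDensity S k) (energyDensity_smul_le S k) c⟩

theorem conj_mem_relaxedHull {S A : M3} (hA : A ∈ relaxedHull S) {R : M3}
    (hR : R ∈ Matrix.specialOrthogonalGroup (Fin 3) ℝ) : Rᵀ * A * R ∈ relaxedHull S := by
  obtain ⟨M, hM⟩ := hA
  exact ⟨M, fun k => (hM k).conj (Matrix.mem_specialOrthogonalGroup_iff.1 hR).1
    (energyDensity_conj S k hR)⟩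

/-- The hull is convex along rank-one segments. -/
theorem laminate_mem_relaxedHull {S B C : M3} {a n : Fin 3 → ℝ}
    (hBC : B - C = Matrix.vecMulVec a n) (hB : B ∈ relaxedHull S) (hC : C ∈ relaxedHull S) {p : ℝ}
    (hp : p ∈ Set.Icc (0 : ℝ) 1) : p • B + (1 - p) • C ∈ relaxedHull S := by
  obtain ⟨M, hM⟩ := hB
  obtain ⟨N, hN⟩ := hC
  exact ⟨p * M + (1 - p) * N, fun k => RelaxedBound.laminate (continuous_energyDensity S k)
    (energyDensity_nonneg S k) hBC (hM k) (hN k) hp⟩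

/-! ### A self-similar laminate -/

/-- A relaxed bound that improves itself affinely with factor `r < 1` improves to the fixed
point. -/
theorem RelaxedBound.of_contraction {g : M3 → ℝ} {U : M3} {t r b : ℝ} (h : RelaxedBound g U t)
    (hr0 : 0 ≤ r) (hr1 : r < 1) (hb : 0 ≤ b)
    (hstep : ∀ t, RelaxedBound g U t → RelaxedBound g U (r * t + b)) :
    RelaxedBound g U (b / (1 - r)) := by
  have hr : 0 < 1 - r := by linarith
  have hn : ∀ n : ℕ, RelaxedBound g U (b / (1 - r) + r ^ n * t) := fun n => by
    induction n with
    | zero => exact h.mono (by simpa using div_nonneg hb hr.le)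
    | succ n ih =>
      refine (hstep _ ih).mono (le_of_eq ?_)
      field_simp
      ring
  refine RelaxedBound.of_forall_pos_add (div_nonneg hb hr.le) fun e he => ?_
  have hlim : Tendsto (fun n : ℕ => r ^ n * t) atTop (𝓝 0) := by
    simpa using (tendsto_pow_atTop_nhds_zero_of_lt_one hr0 hr1).mul_const t
  obtain ⟨n, hn'⟩ := (hlim.eventually (gt_mem_nhds he)).exists
  exact (hn n).mono (by linarith)

/-- One cycle of the construction: `U` is split successively in the directions `n i`, for
`i < j`, off the points `U - τ n i ⊗ n i` of `K(S)`. The distance of the pieces to `K(S)` is of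
the order of the step `x`. -/
theorem RelaxedBound.split_off {S U : M3} {k : ℕ} {n : ℕ → Fin 3 → ℝ} {τ x D : ℝ} (hx : 0 < x)
    (hx1 : x ≤ 1) {N : ℕ}
    (hK : ∀ i < N, U - τ • Matrix.vecMulVec (n i) (n i) ∈ K S)
    (hD : |τ| * ∑ i ∈ Finset.range N, ‖Matrix.vecMulVec (n i) (n i)‖ ≤ D) :
    ∀ j ≤ N, ∀ t, RelaxedBound (energyDensity S k)
        (U + (τ * x) • ∑ i ∈ Finset.range j, Matrix.vecMulVec (n i) (n i)) t →
      RelaxedBound (energyDensity S k) U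
        (j * (x / (1 + x)) * (k * (D * x) ^ 3 + (‖U‖ + 2 * D) ^ 3) + (1 / (1 + x)) ^ j * t) := by
  intro j
  induction j with
  | zero => intro _ t ht; simpa using ht
  | succ j ih =>
    intro hj t ht
    have hD0 : 0 ≤ D := le_trans (by positivity) hD
    set P : ℕ → M3 := fun i => Matrix.vecMulVec (n i) (n i) with hP
    set X : M3 := (τ * x) • ∑ i ∈ Finset.range j, P i with hX
    set a : ℝ := k * (D * x) ^ 3 + (‖U‖ + 2 * D) ^ 3 with ha
    have ha0 : 0 ≤ a := by positivity
    have hsum : ∀ i ≤ N, |τ| * ∑ l ∈ Finset.range i, ‖P l‖ ≤ D := fun i hi => by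
      refine le_trans ?_ hD
      gcongr
    have hXn : ‖X‖ ≤ D * x := by
      rw [hX, norm_smul, Real.norm_eq_abs, abs_mul, abs_of_pos hx]
      calc |τ| * x * ‖∑ i ∈ Finset.range j, P i‖
          ≤ |τ| * x * ∑ i ∈ Finset.range j, ‖P i‖ := by gcongr; exact norm_sum_le _ _
        _ = (|τ| * ∑ i ∈ Finset.range j, ‖P i‖) * x := by ring
        _ ≤ D * x := by gcongr; exact hsum j (by omega)
    have hPj : |τ| * ‖P j‖ ≤ D := by
      refine le_trans ?_ (hsum (j + 1) hj)
      gcongr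
      exact Finset.single_le_sum (f := fun i => ‖P i‖) (fun _ _ => norm_nonneg _)
        (Finset.self_mem_range_succ j)
    have hB : RelaxedBound (energyDensity S k) (U - τ • P j + X) a := by
      refine (RelaxedBound.self _ (energyDensity_nonneg S k _)).mono
        ((energyDensity_le_of_mem_K (hK j (by omega)) k X).trans ?_)
      have h1 : ‖U - τ • P j‖ ≤ ‖U‖ + D := by
        refine (norm_sub_le _ _).trans ?_
        rw [norm_smul, Real.norm_eq_abs]
        linarith
      have h2 : D * x ≤ D := by nlinarith
      have h3 : ‖U - τ • P j‖ + ‖X‖ ≤ ‖U‖ + 2 * D := by linarith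
      exact add_le_add (by gcongr) (pow_le_pow_left₀ (by positivity) h3 3)
    have hsucc : (τ * x) • ∑ i ∈ Finset.range (j + 1), P i = X + (τ * x) • P j := by
      rw [Finset.sum_range_succ, smul_add]
    have hrank : (U - τ • P j + X) - (U + (τ * x) • ∑ i ∈ Finset.range (j + 1), P i) =
        Matrix.vecMulVec ((-(τ * (1 + x))) • n j) (n j) := by
      rw [Matrix.smul_vecMulVec, hsucc]
      change _ = (-(τ * (1 + x))) • P j
      module
    have hw : x / (1 + x) ∈ Set.Icc (0 : ℝ) 1 :=
      ⟨by positivity, by rw [div_le_one (by positivity)]; linarith⟩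
    have hlam := RelaxedBound.laminate (continuous_energyDensity S k) (energyDensity_nonneg S k)
      hrank hB ht hw
    have hw' : 1 - x / (1 + x) = 1 / (1 + x) := by field_simp; ring
    have hcomb : (x / (1 + x)) • (U - τ • P j + X) +
        (1 - x / (1 + x)) • (U + (τ * x) • ∑ i ∈ Finset.range (j + 1), P i) = U + X := by
      rw [hsucc]
      match_scalars <;> field_simp <;> ring
    rw [hcomb, hw'] at hlam
    refine (ih (by omega) _ hlam).mono ?_
    have hq : (1 / (1 + x)) ^ j ≤ 1 := pow_le_one₀ (by positivity)
      (by rw [div_le_one (by positivity)]; linarith)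
    have hwa : 0 ≤ x / (1 + x) * a := by positivity
    have : (1 / (1 + x)) ^ j * (x / (1 + x) * a) ≤ x / (1 + x) * a := by nlinarith
    push_cast
    rw [pow_succ]
    linarith

/-- If `U` is the average of the rank-one matrices `n i ⊗ n i`, all the points
`U - τ n i ⊗ n i` lie in `K(S)`, and `τ < 1/3`, then `U` lies in the hull: splitting off these
points infinitesimally in turn reproduces a multiple of `U`, and the volume occupied by the
multiple decreases faster than the cube of its size increases. -/
theorem mem_relaxedHull_of_average {S U : M3} {n : ℕ → Fin 3 → ℝ} {τ : ℝ} (hτ : 3 * τ < 1)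
    (hK : ∀ i < 4, U - τ • Matrix.vecMulVec (n i) (n i) ∈ K S)
    (hU : ∑ i ∈ Finset.range 4, Matrix.vecMulVec (n i) (n i) = (4 : ℝ) • U) :
    U ∈ relaxedHull S := by
  set D : ℝ := |τ| * ∑ i ∈ Finset.range 4, ‖Matrix.vecMulVec (n i) (n i)‖ with hD
  have hD0 : 0 ≤ D := by positivity
  have hτ' : 0 < 1 - 3 * τ := by linarith
  set c : ℝ := 48 * τ ^ 2 + 64 * |τ| ^ 3 with hc
  have hc0 : 0 ≤ c := by positivity
  set x₀ : ℝ := min 1 (min (1 / (4 * |τ| + 1)) (2 * (1 - 3 * τ) / (c + 1))) with hx₀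
  have hx₀0 : 0 < x₀ := by positivity
  refine ⟨16 * (D ^ 3 + (‖U‖ + 2 * D) ^ 3) / (1 - 3 * τ), fun k => ?_⟩
  -- the step is small enough for the penalty `k` not to matter
  obtain ⟨x, hx0, hxx₀, hkx⟩ : ∃ x : ℝ, 0 < x ∧ x ≤ x₀ ∧ k * x ^ 3 ≤ 1 := by
    refine ⟨min x₀ (1 / (k + 1)), by positivity, min_le_left _ _, ?_⟩
    have h1 : min x₀ (1 / ((k : ℝ) + 1)) ≤ 1 / (k + 1) := min_le_right _ _
    have h0 : 0 < min x₀ (1 / ((k : ℝ) + 1)) := by positivity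
    set y := min x₀ (1 / ((k : ℝ) + 1))
    have hy1 : y ≤ 1 := h1.trans (by
      rw [div_le_one (by positivity)]; linarith [k.cast_nonneg (α := ℝ)])
    rw [le_div_iff₀ (by positivity)] at h1
    have hy3 : y ^ 3 ≤ y := by
      calc y ^ 3 ≤ y ^ 1 := pow_le_pow_of_le_one h0.le hy1 (by norm_num)
        _ = y := pow_one y
    calc (k : ℝ) * y ^ 3 ≤ k * y := by gcongr
      _ ≤ 1 := by nlinarith
  have hx1 : x ≤ 1 := hxx₀.trans (min_le_left _ _)
  have hx2 : |τ| * x * 4 ≤ 1 := by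
    have h := hxx₀.trans ((min_le_right _ _).trans (min_le_left _ _))
    rw [le_div_iff₀ (by positivity)] at h
    nlinarith
  have hx3 : c * x ≤ 2 * (1 - 3 * τ) := by
    have h := hxx₀.trans ((min_le_right _ _).trans (min_le_right _ _))
    rw [le_div_iff₀ (by positivity)] at h
    nlinarith
  have hpos : 0 ≤ 1 + 4 * (τ * x) := by
    have : -(|τ| * x) ≤ τ * x := by nlinarith [neg_abs_le τ]
    linarith
  set a : ℝ := k * (D * x) ^ 3 + (‖U‖ + 2 * D) ^ 3 with ha
  have ha0 : 0 ≤ a := by positivity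
  have ha1 : a ≤ D ^ 3 + (‖U‖ + 2 * D) ^ 3 := by
    have : (k : ℝ) * (D * x) ^ 3 ≤ D ^ 3 := by
      calc (k : ℝ) * (D * x) ^ 3 = D ^ 3 * (k * x ^ 3) := by ring
        _ ≤ D ^ 3 * 1 := by gcongr
        _ = D ^ 3 := mul_one _
    rw [ha]
    linarith
  set r : ℝ := (1 / (1 + x)) ^ 4 * (1 + 4 * (τ * x)) ^ 3 with hr
  have hr0 : 0 ≤ r := by positivity
  -- the key estimate `(1 + x)⁴ - (1 + 4 τ x)³ ≥ (1 - 3 τ) x (1 + x)³ / 4`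
  have hgap : (1 - 3 * τ) / 4 * (x / (1 + x)) ≤ 1 - r := by
    have e1 : 1 - r = ((1 + x) ^ 4 - (1 + 4 * (τ * x)) ^ 3) / (1 + x) ^ 4 := by
      rw [hr]; field_simp
    have e2 : (1 - 3 * τ) / 4 * (x / (1 + x)) =
        ((1 - 3 * τ) / 4 * x * (1 + x) ^ 3) / (1 + x) ^ 4 := by field_simp
    rw [e1, e2]
    refine div_le_div_of_nonneg_right ?_ (by positivity)
    have h8 : (1 + x) ^ 3 ≤ 8 := by
      calc (1 + x) ^ 3 ≤ (1 + 1) ^ 3 := by gcongr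
        _ = 8 := by norm_num
    have h9 : (1 - 3 * τ) / 4 * x * (1 + x) ^ 3 ≤ (1 - 3 * τ) / 4 * x * 8 := by gcongr
    have h10 : 1 + 4 * x ≤ (1 + x) ^ 4 := by nlinarith [sq_nonneg x, pow_pos hx0 3, pow_pos hx0 4]
    have h11 : (1 + 4 * (τ * x)) ^ 3 ≤ 1 + 12 * τ * x + c * x * x := by
      have hτ3 : τ ^ 3 ≤ |τ| ^ 3 := by rw [← abs_pow]; exact le_abs_self _
      have hx32 : x ^ 3 ≤ x ^ 2 := pow_le_pow_of_le_one hx0.le hx1 (by norm_num)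
      have : τ ^ 3 * x ^ 3 ≤ |τ| ^ 3 * x ^ 2 := by
        calc τ ^ 3 * x ^ 3 ≤ |τ| ^ 3 * x ^ 3 := by gcongr
          _ ≤ |τ| ^ 3 * x ^ 2 := by gcongr
      rw [hc]
      nlinarith
    have h12 : c * x * x ≤ 2 * (1 - 3 * τ) * x := by gcongr
    linarith
  have hw0 : 0 < x / (1 + x) := by positivity
  have hr1 : r < 1 := by
    have : 0 < (1 - 3 * τ) / 4 * (x / (1 + x)) := by positivity
    linarith
  have hstep : ∀ t, RelaxedBound (energyDensity S k) U t →
      RelaxedBound (energyDensity S k) U (r * t + 4 * (x / (1 + x)) * a) := fun t ht => by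
    have h1 := ht.smul (continuous_energyDensity S k) (energyDensity_smul_le S k)
      (1 + 4 * (τ * x))
    have h2 : (1 + 4 * (τ * x)) • U =
        U + (τ * x) • ∑ i ∈ Finset.range 4, Matrix.vecMulVec (n i) (n i) := by
      rw [hU]; module
    rw [h2, abs_of_nonneg hpos] at h1
    refine (RelaxedBound.split_off hx0 hx1 hK le_rfl 4 le_rfl _ h1).mono (le_of_eq ?_)
    rw [hr]
    push_cast
    ring
  refine (RelaxedBound.of_contraction (RelaxedBound.self U (energyDensity_nonneg S k U)) hr0 hr1
    (by positivity) hstep).mono ?_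
  rw [div_le_div_iff₀ (by linarith) hτ']
  have hD4 : 0 ≤ D ^ 3 + (‖U‖ + 2 * D) ^ 3 := by positivity
  calc 4 * (x / (1 + x)) * a * (1 - 3 * τ)
      ≤ 4 * (x / (1 + x)) * (D ^ 3 + (‖U‖ + 2 * D) ^ 3) * (1 - 3 * τ) := by gcongr
    _ = 16 * (D ^ 3 + (‖U‖ + 2 * D) ^ 3) * ((1 - 3 * τ) / 4 * (x / (1 + x))) := by ring
    _ ≤ 16 * (D ^ 3 + (‖U‖ + 2 * D) ^ 3) * (1 - r) := by gcongr

/-! ### Diagonalization by rotations -/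

/-- Symmetric matrices with the same characteristic polynomial are conjugate by a rotation. -/
theorem exists_conj_of_charpoly_eq {A B : M3} (hA : A.IsSymm) (hB : B.IsSymm)
    (h : A.charpoly = B.charpoly) :
    ∃ R ∈ Matrix.specialOrthogonalGroup (Fin 3) ℝ, A = Rᵀ * B * R := by
  have hA' : A.IsHermitian := by
    rw [Matrix.IsHermitian, Matrix.conjTranspose_eq_transpose_of_trivial]; exact hA
  have hB' : B.IsHermitian := by
    rw [Matrix.IsHermitian, Matrix.conjTranspose_eq_transpose_of_trivial]; exact hB
  have he := (Matrix.IsHermitian.eigenvalues_eq_eigenvalues_iff hA' hB').2 h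
  have sA := hA'.spectral_theorem
  have sB := hB'.spectral_theorem
  rw [Unitary.conjStarAlgAut_apply] at sA sB
  rw [he] at sA
  set P : M3 := hA'.eigenvectorUnitary.1 with hP
  set Q : M3 := hB'.eigenvectorUnitary.1 with hQ
  set E : M3 := Matrix.diagonal (RCLike.ofReal ∘ hB'.eigenvalues) with hE
  have hPm : P ∈ Matrix.orthogonalGroup (Fin 3) ℝ := hA'.eigenvectorUnitary.2
  have hQm : Q ∈ Matrix.orthogonalGroup (Fin 3) ℝ := hB'.eigenvectorUnitary.2
  have hQQ : star Q * Q = 1 := (Unitary.mem_iff.1 hQm).1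
  set T : M3 := Q * star P with hT
  have hTm : T ∈ Matrix.orthogonalGroup (Fin 3) ℝ := mul_mem hQm (Unitary.star_mem hPm)
  have hTA : A = Tᵀ * B * T := by
    have hTt : Tᵀ = P * star Q := by
      have : Tᵀ = star T := by
        rw [Matrix.star_eq_conjTranspose, Matrix.conjTranspose_eq_transpose_of_trivial]
      rw [this, hT, star_mul, star_star]
    rw [hTt, hT, sB]
    calc A = P * E * star P := sA
      _ = P * (star Q * Q) * E * (star Q * Q) * star P := by
          rw [hQQ, Matrix.mul_one, Matrix.mul_one]
      _ = _ := by simp only [Matrix.mul_assoc]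
  have hTT : T * Tᵀ = 1 := (Matrix.mem_orthogonalGroup_iff (Fin 3) ℝ).1 hTm
  have hdet : T.det * T.det = 1 := by
    have := congrArg Matrix.det hTT
    rwa [Matrix.det_mul, Matrix.det_transpose, Matrix.det_one] at this
  rcases mul_self_eq_one_iff.1 hdet with h1 | h1
  · exact ⟨T, Matrix.mem_specialOrthogonalGroup_iff.2 ⟨hTm, h1⟩, hTA⟩
  · refine ⟨-T, Matrix.mem_specialOrthogonalGroup_iff.2 ⟨?_, ?_⟩, ?_⟩
    · rw [Matrix.mem_orthogonalGroup_iff, Matrix.transpose_neg, neg_mul_neg]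
      exact hTT
    · rw [Matrix.det_neg, h1]
      norm_num
    · rw [Matrix.transpose_neg, Matrix.neg_mul, Matrix.neg_mul, Matrix.mul_neg, neg_neg]
      exact hTA

theorem charpoly_eq_of_forall_det_eq {A B : M3}
    (h : ∀ x : ℝ, (x • (1 : M3) - A).det = (x • (1 : M3) - B).det) : A.charpoly = B.charpoly := by
  have key : ∀ (M : M3) (x : ℝ), M.charpoly.eval x = (x • (1 : M3) - M).det := fun M x => by
    rw [Matrix.eval_charpoly, Matrix.scalar_apply, ← Matrix.smul_one_eq_diagonal]
  refine Polynomial.funext fun x => ?_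
  rw [key, key, h]

theorem mem_relaxedHull_of_charpoly_eq {S A B : M3} (hA : A.IsSymm) (hB : B.IsSymm)
    (h : A.charpoly = B.charpoly) (hBS : B ∈ relaxedHull S) : A ∈ relaxedHull S := by
  obtain ⟨R, hR, rfl⟩ := exists_conj_of_charpoly_eq hA hB h
  exact conj_mem_relaxedHull hBS hR

/-! ### The uniaxial points -/

section Roots

variable {s₁ s₂ s₃ : ℝ}

theorem H_neg_of_between (h₁ : 0 < s₁) (h₁₂ : s₁ < s₂) (h₂₃ : s₂ < s₃)
    (hsum : s₁ + s₂ + s₃ = 1) : H s₁ s₂ s₃ s₂ < 0 ∧ H s₁ s₂ s₃ (1 / 3) < 0 := by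
  obtain rfl : s₁ = 1 - s₂ - s₃ := by linarith
  have hp : 0 < (s₂ - (1 - s₂ - s₃)) * (s₃ - s₂) := mul_pos (by linarith) (by linarith)
  have e1 : H (1 - s₂ - s₃) s₂ s₃ s₂ = -(s₂ * ((s₂ - (1 - s₂ - s₃)) * (s₃ - s₂))) := by
    unfold H; ring
  have e2 : H (1 - s₂ - s₃) s₂ s₃ (1 / 3) = -((s₂ - (1 - s₂ - s₃)) * (s₃ - s₂) / 3) := by
    unfold H; ring
  rw [e1, e2]
  have : 0 < s₂ * ((s₂ - (1 - s₂ - s₃)) * (s₃ - s₂)) := mul_pos (by linarith) hp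
  constructor <;> linarith

/-- The roots of `H` lie between `(s₁ + s₂) / 2` and `(s₂ + s₃) / 2`: the convex function `H` is
positive at both points and negative at `1/3` between them. -/
theorem root_bounds (h₁ : 0 < s₁) (h₁₂ : s₁ < s₂) (h₂₃ : s₂ < s₃) (hsum : s₁ + s₂ + s₃ = 1)
    {u : ℝ} (hu : H s₁ s₂ s₃ u = 0) : s₁ + s₂ ≤ 2 * u ∧ 2 * u ≤ s₂ + s₃ := by
  have hneg := (H_neg_of_between h₁ h₁₂ h₂₃ hsum).2
  have hlo : H s₁ s₂ s₃ ((s₁ + s₂) / 2) = (s₂ - s₁) ^ 2 * s₃ / 2 := by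
    obtain rfl : s₃ = 1 - s₁ - s₂ := by linarith
    unfold H; ring
  have hhi : H s₁ s₂ s₃ ((s₂ + s₃) / 2) = (s₃ - s₂) ^ 2 * s₁ / 2 := by
    obtain rfl : s₁ = 1 - s₂ - s₃ := by linarith
    unfold H; ring
  have hlo' : 0 < H s₁ s₂ s₃ ((s₁ + s₂) / 2) := by
    rw [hlo]
    have : 0 < s₂ - s₁ := by linarith
    have : 0 < s₃ := by linarith
    positivity
  have hhi' : 0 < H s₁ s₂ s₃ ((s₂ + s₃) / 2) := by
    rw [hhi]
    have : 0 < s₃ - s₂ := by linarith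
    positivity
  have hconv : ∀ x y z : ℝ, x < y → y < z →
      (z - x) * H s₁ s₂ s₃ y ≤ (z - y) * H s₁ s₂ s₃ x + (y - x) * H s₁ s₂ s₃ z := by
    intro x y z hxy hyz
    have h2 : 0 < s₂ := by linarith
    have : 0 ≤ 6 * s₂ * ((y - x) * (z - y) * (z - x)) := by
      have := sub_pos.2 hxy
      have := sub_pos.2 hyz
      have : 0 < z - x := by linarith
      positivity
    have e : (z - y) * H s₁ s₂ s₃ x + (y - x) * H s₁ s₂ s₃ z - (z - x) * H s₁ s₂ s₃ y =
        6 * s₂ * ((y - x) * (z - y) * (z - x)) := by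
      unfold H; ring
    linarith
  constructor
  · by_contra! hcon
    have h := hconv u ((s₁ + s₂) / 2) (1 / 3) (by linarith) (by linarith)
    rw [hu] at h
    nlinarith [mul_pos (show 0 < 1 / 3 - u by linarith) hlo',
      mul_neg_of_pos_of_neg (show 0 < (s₁ + s₂) / 2 - u by linarith) hneg]
  · by_contra! hcon
    have h := hconv (1 / 3) ((s₂ + s₃) / 2) u (by linarith) (by linarith)
    rw [hu] at h
    nlinarith [mul_pos (show 0 < u - 1 / 3 by linarith) hhi',
      mul_neg_of_pos_of_neg (show 0 < u - (s₂ + s₃) / 2 by linarith) hneg]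

/-- The smallest and the greatest root of `H` are roots. -/
theorem H_uα_eq_zero_and_H_uβ_eq_zero (h₁ : 0 < s₁) (h₁₂ : s₁ < s₂) (h₂₃ : s₂ < s₃)
    (hsum : s₁ + s₂ + s₃ = 1) :
    H s₁ s₂ s₃ (uα s₁ s₂ s₃) = 0 ∧ H s₁ s₂ s₃ (uβ s₁ s₂ s₃) = 0 := by
  have hc : Continuous (H s₁ s₂ s₃) := by unfold H; fun_prop
  have hcl : IsClosed {x | H s₁ s₂ s₃ x = 0} := isClosed_eq hc continuous_const
  have hne : {x | H s₁ s₂ s₃ x = 0}.Nonempty := by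
    have h0 : H s₁ s₂ s₃ 0 = 2 * s₂ ^ 2 := by unfold H; ring
    have hs : (0 : ℝ) ∈ Set.Icc (H s₁ s₂ s₃ (1 / 3)) (H s₁ s₂ s₃ 0) :=
      ⟨(H_neg_of_between h₁ h₁₂ h₂₃ hsum).2.le, by rw [h0]; positivity⟩
    obtain ⟨x, -, hx⟩ := intermediate_value_Icc' (by norm_num) hc.continuousOn hs
    exact ⟨x, hx⟩
  exact ⟨hcl.csInf_mem hne ⟨(s₁ + s₂) / 2, fun x hx => by
      linarith [(root_bounds h₁ h₁₂ h₂₃ hsum hx).1]⟩,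
    hcl.csSup_mem hne ⟨(s₂ + s₃) / 2, fun x hx => by
      linarith [(root_bounds h₁ h₁₂ h₂₃ hsum hx).2]⟩⟩

/-- At a root `u` of `H`, the vectors `v` with `v₀² + v₁² = 2u` and `v₂² = 1 - 2u` connect the
uniaxial matrix `diag(u, u, 1 - 2u)` to the multiple `u / s₂` of a rotated crystal. -/
theorem uniaxial_sub_mem_K (h₂ : 0 < s₂) (hsum : s₁ + s₂ + s₃ = 1) {u : ℝ}
    (hu : H s₁ s₂ s₃ u = 0) {v : Fin 3 → ℝ} (hv : v 0 ^ 2 + v 1 ^ 2 = 2 * u)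
    (hv2 : v 2 ^ 2 = 1 - 2 * u) :
    Matrix.diagonal ![u, u, 1 - 2 * u] - (1 - u / s₂) • Matrix.vecMulVec v v ∈
      K (crystal s₁ s₂ s₃) := by
  obtain ⟨α, rfl⟩ : ∃ α, u = α * s₂ := ⟨u / s₂, by field_simp⟩
  rw [mul_div_cancel_right₀ α h₂.ne']
  have hk : α * s₁ * s₃ = s₂ * (1 - 2 * (α * s₂)) * (3 * α - 2) := by
    unfold H at hu
    refine mul_left_cancel₀ h₂.ne' ?_
    linear_combination hu
  obtain rfl : s₃ = 1 - s₁ - s₂ := by linarith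
  have hsymm : (Matrix.diagonal ![α * s₂, α * s₂, 1 - 2 * (α * s₂)] -
      (1 - α) • Matrix.vecMulVec v v).IsSymm := by
    rw [Matrix.IsSymm, Matrix.transpose_sub, Matrix.transpose_smul, Matrix.transpose_vecMulVec,
      Matrix.diagonal_transpose]
  have hsymm' : (α • crystal s₁ s₂ (1 - s₁ - s₂)).IsSymm := (Matrix.isSymm_diagonal _).smul α
  obtain ⟨R, hR, hAR⟩ := exists_conj_of_charpoly_eq hsymm hsymm' <|
    charpoly_eq_of_forall_det_eq fun x => by
      simp [crystal, Matrix.det_fin_three, Matrix.vecMulVec_apply]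
      linear_combination (1 - α) * (x - α * s₂) * (x - 1 + 2 * (α * s₂)) * hv +
        (1 - α) * (x - α * s₂) ^ 2 * hv2 - (x - α * s₂) * α * hk
  refine ⟨α, R, hR, ?_⟩
  rw [hAR, Matrix.mul_smul, Matrix.smul_mul]

/-- The uniaxial matrices attached to the roots of `H` are attainable. -/
theorem uniaxial_mem_relaxedHull (h₁ : 0 < s₁) (h₁₂ : s₁ < s₂) (h₂₃ : s₂ < s₃)
    (hsum : s₁ + s₂ + s₃ = 1) {u : ℝ} (hu : H s₁ s₂ s₃ u = 0) :
    Matrix.diagonal ![u, u, 1 - 2 * u] ∈ relaxedHull (crystal s₁ s₂ s₃) := by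
  obtain ⟨hlo, hhi⟩ := root_bounds h₁ h₁₂ h₂₃ hsum hu
  have h₂ : 0 < s₂ := by linarith
  have hu0 : 0 < u := by linarith
  have hu1 : 0 < 1 - 2 * u := by linarith
  have h32 : 2 * s₂ < 3 * u := by
    have hk : u * s₁ * s₃ = s₂ * (1 - 2 * u) * (3 * u - 2 * s₂) := by
      unfold H at hu
      linear_combination hu
    have hpos : 0 < u * s₁ * s₃ := mul_pos (mul_pos hu0 h₁) (by linarith)
    rw [hk] at hpos
    have := pos_of_mul_pos_right hpos (mul_pos h₂ hu1).le
    linarith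
  have ha : √(2 * u) ^ 2 = 2 * u := Real.sq_sqrt (by linarith)
  have hb : √(1 - 2 * u) ^ 2 = 1 - 2 * u := Real.sq_sqrt hu1.le
  set a := √(2 * u)
  set b := √(1 - 2 * u)
  refine mem_relaxedHull_of_average (τ := 1 - u / s₂)
    (n := fun i => match i with
      | 0 => ![a, 0, b]
      | 1 => ![-a, 0, b]
      | 2 => ![0, a, b]
      | _ => ![0, -a, b]) ?_ (fun i hi => ?_) ?_
  · have : 2 / 3 < u / s₂ := by rw [lt_div_iff₀ h₂]; linarith
    linarith
  · refine uniaxial_sub_mem_K h₂ hsum hu ?_ ?_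
    · interval_cases i <;> simp [ha]
    · interval_cases i <;> simp [hb]
  · ext i j
    fin_cases i <;> fin_cases j <;>
      simp [Finset.sum_range_succ, Matrix.add_apply] <;>
      linarith

end Roots

/-! ### Points on the curves -/

/-- The points of the unit-trace plane with coordinates in `[s₁, s₃]` whose diagonal matrix lies in
the hull of the crystal. -/
def attainable (s₁ s₂ s₃ : ℝ) : Set (Fin 3 → ℝ) :=
  {m | Matrix.diagonal m ∈ relaxedHull (crystal s₁ s₂ s₃) ∧ (∀ i, m i ∈ Set.Icc s₁ s₃) ∧
    ∑ i, m i = 1}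

variable {s₁ s₂ s₃ : ℝ}

theorem comp_perm_mem_attainable {m : Fin 3 → ℝ} (hm : m ∈ attainable s₁ s₂ s₃)
    (σ : Equiv.Perm (Fin 3)) : m ∘ σ ∈ attainable s₁ s₂ s₃ := by
  refine ⟨mem_relaxedHull_of_charpoly_eq (Matrix.isSymm_diagonal _) (Matrix.isSymm_diagonal _) ?_
    hm.1, fun i => hm.2.1 _, ?_⟩
  · rw [Matrix.charpoly_diagonal, Matrix.charpoly_diagonal]
    exact Equiv.prod_comp σ fun i => Polynomial.X - Polynomial.C (m i)
  · rw [← hm.2.2]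
    exact Equiv.sum_comp σ m

theorem mem_attainable_of_isOrderedEigenvalues {M : M3} (hM : M.IsSymm)
    (hMS : M ∈ relaxedHull (crystal s₁ s₂ s₃)) (hlo : (M - s₁ • (1 : M3)).PosSemidef)
    (hhi : (s₃ • (1 : M3) - M).PosSemidef) (htr : M.trace = 1) {m : Fin 3 → ℝ}
    (hm : IsOrderedEigenvalues M m) : m ∈ attainable s₁ s₂ s₃ := by
  have hchar : (Matrix.diagonal m).charpoly = M.charpoly := by
    rw [hm.2, Matrix.charpoly_diagonal]
  obtain ⟨R, hR, hmR⟩ := exists_conj_of_charpoly_eq (Matrix.isSymm_diagonal m) hM hchar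
  have hRR := transpose_mul_of_mem_specialOrthogonalGroup hR
  refine ⟨hmR ▸ conj_mem_relaxedHull hMS hR, fun i => ⟨?_, ?_⟩, ?_⟩
  · have h := hlo.conjTranspose_mul_mul_same R
    rw [Matrix.conjTranspose_eq_transpose_of_trivial, Matrix.mul_sub, Matrix.sub_mul, ← hmR,
      Matrix.mul_smul, Matrix.mul_one, Matrix.smul_mul, hRR, Matrix.smul_one_eq_diagonal,
      Matrix.diagonal_sub] at h
    have := Matrix.posSemidef_diagonal_iff.1 h i
    linarith
  · have h := hhi.conjTranspose_mul_mul_same R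
    rw [Matrix.conjTranspose_eq_transpose_of_trivial, Matrix.mul_sub, Matrix.sub_mul, ← hmR,
      Matrix.mul_smul, Matrix.mul_one, Matrix.smul_mul, hRR, Matrix.smul_one_eq_diagonal,
      Matrix.diagonal_sub] at h
    have := Matrix.posSemidef_diagonal_iff.1 h i
    linarith
  · rw [← Matrix.trace_diagonal, hmR, Matrix.trace_mul_comm, ← Matrix.mul_assoc,
      mul_transpose_of_mem_specialOrthogonalGroup hR, Matrix.one_mul, htr]

theorem posSemidef_conj_diagonal_sub {d : Fin 3 → ℝ} {R : M3}
    (hR : R ∈ Matrix.specialOrthogonalGroup (Fin 3) ℝ) {a b : ℝ} (h : ∀ i, d i ∈ Set.Icc a b) :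
    (Rᵀ * Matrix.diagonal d * R - a • (1 : M3)).PosSemidef ∧
      (b • (1 : M3) - Rᵀ * Matrix.diagonal d * R).PosSemidef := by
  have hRR := transpose_mul_of_mem_specialOrthogonalGroup hR
  have e : ∀ c : ℝ, c • (1 : M3) = Rᵀ * (c • (1 : M3)) * R := fun c => by
    rw [Matrix.mul_smul, Matrix.mul_one, Matrix.smul_mul, hRR]
  constructor
  · rw [e a, ← Matrix.sub_mul, ← Matrix.mul_sub, Matrix.smul_one_eq_diagonal,
      Matrix.diagonal_sub, ← Matrix.conjTranspose_eq_transpose_of_trivial]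
    exact (Matrix.posSemidef_diagonal_iff.2 fun i => sub_nonneg.2
      (h i).1).conjTranspose_mul_mul_same R
  · rw [e b, ← Matrix.sub_mul, ← Matrix.mul_sub, Matrix.smul_one_eq_diagonal,
      Matrix.diagonal_sub, ← Matrix.conjTranspose_eq_transpose_of_trivial]
    exact (Matrix.posSemidef_diagonal_iff.2 fun i => sub_nonneg.2
      (h i).2).conjTranspose_mul_mul_same R

/-- If a rotated uniaxial matrix `W` is rank-one connected to `(u / s₂) S`, then the laminates of
`W` and `(u / s₂) S`, normalized to unit trace, are attainable. -/
theorem laminate_mem_attainable (h₁ : 0 < s₁) (h₁₂ : s₁ < s₂) (h₂₃ : s₂ < s₃)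
    (hsum : s₁ + s₂ + s₃ = 1) {u : ℝ} (hu : H s₁ s₂ s₃ u = 0) {W : M3} (hW : W.IsSymm)
    (hchar : W.charpoly = (Matrix.diagonal ![u, u, 1 - 2 * u] : M3).charpoly) {a n : Fin 3 → ℝ}
    (hrank : W - (u / s₂) • crystal s₁ s₂ s₃ = Matrix.vecMulVec a n) {p : ℝ}
    (hp : p ∈ Set.Icc (0 : ℝ) 1) {m : Fin 3 → ℝ}
    (hm : IsOrderedEigenvalues (η (u / s₂) p • W + (1 - η (u / s₂) p) • crystal s₁ s₂ s₃) m) :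
    m ∈ attainable s₁ s₂ s₃ := by
  obtain ⟨hlo, hhi⟩ := root_bounds h₁ h₁₂ h₂₃ hsum hu
  have h₂ : 0 < s₂ := by linarith
  have hα : 0 < u / s₂ := div_pos (by linarith) h₂
  obtain ⟨R, hR, hWR⟩ := exists_conj_of_charpoly_eq hW (Matrix.isSymm_diagonal _) hchar
  have hWS : W ∈ relaxedHull (crystal s₁ s₂ s₃) :=
    hWR ▸ conj_mem_relaxedHull (uniaxial_mem_relaxedHull h₁ h₁₂ h₂₃ hsum hu) hR
  have hS : crystal s₁ s₂ s₃ ∈ K (crystal s₁ s₂ s₃) := ⟨1, 1, one_mem _, by simp⟩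
  set α := u / s₂
  have hD : 0 < p + (1 - p) * α := by
    rcases hp.1.eq_or_lt with h | h
    · rw [← h]; simpa using hα
    · have : 0 ≤ (1 - p) * α := mul_nonneg (by linarith [hp.2]) hα.le
      linarith
  have hη0 : 0 ≤ η α p := div_nonneg hp.1 hD.le
  have hη1 : 0 ≤ 1 - η α p := by
    rw [η, sub_nonneg, div_le_one hD]
    linarith [mul_nonneg (show 0 ≤ 1 - p by linarith [hp.2]) hα.le]
  have hWtr : W.trace = 1 := by
    rw [hWR, Matrix.trace_mul_comm, ← Matrix.mul_assoc,
      mul_transpose_of_mem_specialOrthogonalGroup hR, Matrix.one_mul, Matrix.trace_diagonal]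
    simp [Fin.sum_univ_three]
    ring
  have hStr : (crystal s₁ s₂ s₃).trace = 1 := by
    rw [crystal, Matrix.trace_diagonal]
    simpa [Fin.sum_univ_three] using hsum
  have hWb := posSemidef_conj_diagonal_sub hR (d := ![u, u, 1 - 2 * u]) (a := s₁) (b := s₃)
    (fun i => by fin_cases i <;> constructor <;> simp <;> linarith)
  have hSb := posSemidef_conj_diagonal_sub (R := 1) (one_mem _) (d := ![s₁, s₂, s₃]) (a := s₁)
    (b := s₃) (fun i => by fin_cases i <;> constructor <;> simp <;> linarith)
  rw [← hWR] at hWb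
  rw [Matrix.transpose_one, Matrix.one_mul, Matrix.mul_one] at hSb
  refine mem_attainable_of_isOrderedEigenvalues ?_ ?_ ?_ ?_ ?_ hm
  · exact (hW.smul _).add ((Matrix.isSymm_diagonal _).smul _)
  · have h := smul_mem_relaxedHull (laminate_mem_relaxedHull hrank hWS
      (smul_mem_relaxedHull (mem_relaxedHull_of_mem_K hS) α) hp) (p + (1 - p) * α)⁻¹
    convert h using 1
    unfold η
    match_scalars <;> field_simp
    ring
  · convert (hWb.1.smul hη0).add (hSb.1.smul hη1) using 1
    rw [crystal]
    module
  · convert (hWb.2.smul hη0).add (hSb.2.smul hη1) using 1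
    rw [crystal]
    module
  · rw [Matrix.trace_add, Matrix.trace_smul, Matrix.trace_smul, hWtr, hStr]
    simp

theorem exists_vecMulVec_eq {x y z : ℝ} (h : x * z = y * y) :
    ∃ a n : Fin 3 → ℝ, !![x, 0, y; 0, 0, 0; y, 0, z] = Matrix.vecMulVec a n := by
  by_cases hx : x = 0
  · subst hx
    have hy : y = 0 := by simpa using h.symm
    subst hy
    refine ⟨![0, 0, z], ![0, 0, 1], ?_⟩
    ext i j
    fin_cases i <;> fin_cases j <;> simp [Matrix.vecMulVec_apply]
  · refine ⟨![x, 0, y], ![1, 0, y / x], ?_⟩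
    ext i j
    fin_cases i <;> fin_cases j <;> simp [Matrix.vecMulVec_apply]
    · field_simp
    · field_simp
      linarith

/-- The uniaxial matrix with parameter `u`, rotated in the plane of the first and third coordinates
by an angle `θ` with `cos (2 θ) = c`, is rank-one connected to `(u / s₂) S`: the difference
vanishes outside that plane, and its `2 × 2` block has determinant zero. -/
theorem exists_rank_one_connection (h₁₂ : s₁ < s₂) (h₂₃ : s₂ < s₃) (h₂ : 0 < s₂)
    (hsum : s₁ + s₂ + s₃ = 1) {u c d : ℝ} (hu : H s₁ s₂ s₃ u = 0)
    (hc : c = (1 + s₂ - 4 * u) / (s₃ - s₁)) (hd : d * d = (1 - 3 * u) ^ 2 * (1 - c ^ 2) / 4) :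
    ∃ a n : Fin 3 → ℝ, !![(1 - u) / 2 - (1 - 3 * u) / 2 * c, 0, d; 0, u, 0;
        d, 0, (1 - u) / 2 + (1 - 3 * u) / 2 * c] - (u / s₂) • crystal s₁ s₂ s₃ =
      Matrix.vecMulVec a n := by
  have h13 : s₃ - s₁ ≠ 0 := by linarith
  have hcc : c * (s₃ - s₁) = 1 + s₂ - 4 * u := by rw [hc]; field_simp
  obtain ⟨a, n, han⟩ := exists_vecMulVec_eq
    (x := (1 - u) / 2 - (1 - 3 * u) / 2 * c - u / s₂ * s₁) (y := d)
    (z := (1 - u) / 2 + (1 - 3 * u) / 2 * c - u / s₂ * s₃) (by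
      rw [hd]
      obtain ⟨α, rfl⟩ : ∃ α, u = α * s₂ := ⟨u / s₂, by field_simp⟩
      rw [mul_div_cancel_right₀ α h₂.ne']
      have hk : α * s₁ * s₃ = s₂ * (1 - 2 * (α * s₂)) * (3 * α - 2) := by
        unfold H at hu
        refine mul_left_cancel₀ h₂.ne' ?_
        linear_combination hu
      obtain rfl : s₃ = 1 - s₁ - s₂ := by linarith
      linear_combination α * hk + (1 - 3 * (α * s₂)) / 2 * α * hcc)
  refine ⟨a, n, han ▸ ?_⟩
  ext i j
  fin_cases i <;> fin_cases j <;> simp [crystal]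
  field_simp
  ring

theorem cos_bounds (h₁₂ : s₁ < s₂) (h₂₃ : s₂ < s₃) (hsum : s₁ + s₂ + s₃ = 1) {u c : ℝ}
    (hlo : s₁ + s₂ ≤ 2 * u) (hhi : 2 * u ≤ s₂ + s₃) (hc : c = (1 + s₂ - 4 * u) / (s₃ - s₁)) :
    -1 ≤ c ∧ c ≤ 1 := by
  have h13 : 0 < s₃ - s₁ := by linarith
  rw [hc, le_div_iff₀ h13, div_le_one h13]
  constructor <;> linarith

/-- At a root of `H` the expression for the prescribed cosine, whose
denominators do not vanish since `s₂` and `1/3` are not roots, becomes linear in `u`. -/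
theorem cosTwoθα_eq (h₁ : 0 < s₁) (h₁₂ : s₁ < s₂) (h₂₃ : s₂ < s₃) (hsum : s₁ + s₂ + s₃ = 1)
    {u : ℝ} (hu : H s₁ s₂ s₃ u = 0) :
    (u * (s₃ - s₁) + (u - s₂) * cosTwoφ s₁ s₂ s₃ u) / (s₂ * (1 - 3 * u)) =
      (1 + s₂ - 4 * u) / (s₃ - s₁) := by
  have hneg := H_neg_of_between h₁ h₁₂ h₂₃ hsum
  have h13 : s₃ - s₁ ≠ 0 := by linarith
  have h2 : s₂ ≠ 0 := by linarith
  have hus : s₂ - u ≠ 0 := fun h => by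
    rw [← sub_eq_zero.1 h] at hu
    linarith [hneg.1]
  have hu3 : 1 - 3 * u ≠ 0 := fun h => by
    obtain rfl : u = 1 / 3 := by linarith
    linarith [hneg.2]
  have e : (u - s₂) * cosTwoφ s₁ s₂ s₃ u =
      -((2 * s₂ * (3 * s₂ - 1) + u * (1 + s₁ ^ 2 - 9 * s₂ ^ 2 - 2 * s₁ * s₃ + s₃ ^ 2)) /
        (2 * (s₃ - s₁))) := by
    unfold cosTwoφ
    field_simp
    ring
  rw [e, div_eq_div_iff (mul_ne_zero h2 hu3) h13, add_mul, neg_mul, div_mul_eq_mul_div,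
    mul_div_mul_right _ _ h13]
  unfold H at hu
  obtain rfl : s₃ = 1 - s₁ - s₂ := by linarith
  linear_combination -2 * hu

theorem sq_cos_sin_half_arccos {c : ℝ} (h : -1 ≤ c ∧ c ≤ 1) :
    Real.cos (Real.arccos c / 2) ^ 2 = (1 + c) / 2 ∧
      Real.sin (Real.arccos c / 2) ^ 2 = (1 - c) / 2 := by
  have h1 := Real.cos_sq (Real.arccos c / 2)
  have h2 := Real.sin_sq_add_cos_sq (Real.arccos c / 2)
  rw [mul_div_cancel₀ _ (two_ne_zero' ℝ), Real.cos_arccos h.1 h.2] at h1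
  constructor <;> linarith

theorem Γα_subset_attainable (h₁ : 0 < s₁) (h₁₂ : s₁ < s₂) (h₂₃ : s₂ < s₃)
    (hsum : s₁ + s₂ + s₃ = 1) : Γα s₁ s₂ s₃ ⊆ attainable s₁ s₂ s₃ := by
  rintro m ⟨p, hp, hm⟩
  have hu := (H_uα_eq_zero_and_H_uβ_eq_zero h₁ h₁₂ h₂₃ hsum).1
  have hc : cosTwoθα s₁ s₂ s₃ = _ := cosTwoθα_eq h₁ h₁₂ h₂₃ hsum hu
  obtain ⟨hlo, hhi⟩ := root_bounds h₁ h₁₂ h₂₃ hsum hu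
  have hcs := sq_cos_sin_half_arccos (cos_bounds h₁₂ h₂₃ hsum hlo hhi hc)
  rw [← θα] at hcs
  rw [Mα] at hm
  set u := uα s₁ s₂ s₃ with hudef
  set c := cosTwoθα s₁ s₂ s₃
  set C := Real.cos (θα s₁ s₂ s₃) with hC
  set D := Real.sin (θα s₁ s₂ s₃) with hD
  have hW : (Rα s₁ s₂ s₃)ᵀ * Uα s₁ s₂ s₃ * Rα s₁ s₂ s₃ =
      !![(1 - u) / 2 - (1 - 3 * u) / 2 * c, 0, (1 - 3 * u) * (C * D); 0, u, 0;
        (1 - 3 * u) * (C * D), 0, (1 - u) / 2 + (1 - 3 * u) / 2 * c] := by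
    rw [Rα, Uα, ← hudef, ← hC, ← hD]
    ext i j
    fin_cases i <;> fin_cases j <;> simp [Matrix.mul_apply, Fin.sum_univ_three]
    · linear_combination u * hcs.1 + (1 - 2 * u) * hcs.2
    · ring
    · ring
    · linear_combination u * hcs.2 + (1 - 2 * u) * hcs.1
  obtain ⟨a, n, han⟩ := exists_rank_one_connection h₁₂ h₂₃ (h₁.trans h₁₂) hsum hu hc
    (d := (1 - 3 * u) * (C * D)) (by
      linear_combination (1 - 3 * u) ^ 2 * (D ^ 2 * hcs.1 + (1 + c) / 2 * hcs.2))
  refine laminate_mem_attainable h₁ h₁₂ h₂₃ hsum hu ?_ ?_ (hW ▸ han) hp hm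
  · rw [hW]
    ext i j
    fin_cases i <;> fin_cases j <;> simp
  · rw [Matrix.mul_assoc, Matrix.charpoly_mul_comm, Matrix.mul_assoc]
    have hRR : Rα s₁ s₂ s₃ * (Rα s₁ s₂ s₃)ᵀ = 1 := by
      have := Real.sin_sq_add_cos_sq (θα s₁ s₂ s₃)
      ext i j
      fin_cases i <;> fin_cases j <;> simp [Rα, Matrix.mul_apply, Fin.sum_univ_three] <;> nlinarith
    rw [hRR, Matrix.mul_one, Uα]

theorem Γβ_subset_attainable (h₁ : 0 < s₁) (h₁₂ : s₁ < s₂) (h₂₃ : s₂ < s₃)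
    (hsum : s₁ + s₂ + s₃ = 1) : Γβ s₁ s₂ s₃ ⊆ attainable s₁ s₂ s₃ := by
  rintro m ⟨p, hp, hm⟩
  have hu := (H_uα_eq_zero_and_H_uβ_eq_zero h₁ h₁₂ h₂₃ hsum).2
  obtain ⟨hlo, hhi⟩ := root_bounds h₁ h₁₂ h₂₃ hsum hu
  have hc : -cosTwoθβ s₁ s₂ s₃ = (1 + s₂ - 4 * uβ s₁ s₂ s₃) / (s₃ - s₁) := by
    rw [← cosTwoθα_eq h₁ h₁₂ h₂₃ hsum hu, cosTwoθβ, ← neg_div]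
    congr 1
    ring
  have hb := cos_bounds h₁₂ h₂₃ hsum hlo hhi hc
  have hcs := sq_cos_sin_half_arccos (c := cosTwoθβ s₁ s₂ s₃) ⟨by linarith, by linarith⟩
  rw [← θβ] at hcs
  rw [Mβ] at hm
  set u := uβ s₁ s₂ s₃ with hudef
  set c := cosTwoθβ s₁ s₂ s₃
  set C := Real.cos (θβ s₁ s₂ s₃) with hC
  set D := Real.sin (θβ s₁ s₂ s₃) with hD
  have hW : (Rβ s₁ s₂ s₃)ᵀ * Uβ s₁ s₂ s₃ * Rβ s₁ s₂ s₃ =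
      !![(1 - u) / 2 - (1 - 3 * u) / 2 * -c, 0, -((1 - 3 * u) * (C * D)); 0, u, 0;
        -((1 - 3 * u) * (C * D)), 0, (1 - u) / 2 + (1 - 3 * u) / 2 * -c] := by
    rw [Rβ, Uβ, ← hudef, ← hC, ← hD]
    ext i j
    fin_cases i <;> fin_cases j <;> simp [Matrix.mul_apply, Fin.sum_univ_three]
    · linear_combination u * hcs.2 + (1 - 2 * u) * hcs.1
    · ring
    · ring
    · linear_combination u * hcs.1 + (1 - 2 * u) * hcs.2
  obtain ⟨a, n, han⟩ := exists_rank_one_connection h₁₂ h₂₃ (h₁.trans h₁₂) hsum hu hc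
    (d := -((1 - 3 * u) * (C * D))) (by
      linear_combination (1 - 3 * u) ^ 2 * (D ^ 2 * hcs.1 + (1 + c) / 2 * hcs.2))
  refine laminate_mem_attainable h₁ h₁₂ h₂₃ hsum hu ?_ ?_ (hW ▸ han) hp hm
  · rw [hW]
    ext i j
    fin_cases i <;> fin_cases j <;> simp
  · rw [Matrix.mul_assoc, Matrix.charpoly_mul_comm, Matrix.mul_assoc]
    have hRR : Rβ s₁ s₂ s₃ * (Rβ s₁ s₂ s₃)ᵀ = 1 := by
      have := Real.sin_sq_add_cos_sq (θβ s₁ s₂ s₃)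
      ext i j
      fin_cases i <;> fin_cases j <;> simp [Rβ, Matrix.mul_apply, Fin.sum_univ_three] <;> nlinarith
    rw [hRR, Matrix.mul_one, Uβ, Matrix.charpoly_diagonal, Matrix.charpoly_diagonal]
    simp [Fin.prod_univ_three, ← hudef]
    ring

theorem Γ_subset_attainable (h₁ : 0 < s₁) (h₁₂ : s₁ < s₂) (h₂₃ : s₂ < s₃)
    (hsum : s₁ + s₂ + s₃ = 1) : Γ s₁ s₂ s₃ ⊆ attainable s₁ s₂ s₃ := by
  have hα := Γα_subset_attainable h₁ h₁₂ h₂₃ hsum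
  have hβ := Γβ_subset_attainable h₁ h₁₂ h₂₃ hsum
  have e₁₂ : ∀ m, reflect₁₂ m = m ∘ Equiv.swap (0 : Fin 3) 1 := fun m => by
    ext i; fin_cases i <;> rfl
  have e₂₃ : ∀ m, reflect₂₃ m = m ∘ Equiv.swap (1 : Fin 3) 2 := fun m => by
    ext i; fin_cases i <;> rfl
  have er : ∀ m, rotate m = m ∘ (finRotate 3).symm := fun m => by
    ext i; fin_cases i <;> rfl
  have hrot : ∀ (k : ℕ) (m : Fin 3 → ℝ), m ∈ attainable s₁ s₂ s₃ →
      rotate^[k] m ∈ attainable s₁ s₂ s₃ := fun k => by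
    induction k with
    | zero => exact fun m hm => hm
    | succ k ih =>
      exact fun m hm => ih _ (er m ▸ comp_perm_mem_attainable hm _)
  intro m hm
  obtain ⟨k, hk⟩ := Set.mem_iUnion.1 hm
  obtain ⟨m', hm', rfl⟩ := hk
  refine hrot _ _ ?_
  rcases hm' with (h | ⟨y, hy, rfl⟩) | (h | ⟨y, hy, rfl⟩)
  · exact hα h
  · exact e₁₂ y ▸ comp_perm_mem_attainable (hα hy) _
  · exact hβ h
  · exact e₂₃ y ▸ comp_perm_mem_attainable (hβ hy) _

/-! ### Points enclosed by the curve -/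

/-- From a point whose component in the complement of a set is bounded, each line in the plane
meets the set in both directions. -/
theorem exists_ray_mem {G : Set (Fin 3 → ℝ)} {m d : Fin 3 → ℝ} (hm : m ∈ unitTracePlane)
    (hbd : Bornology.IsBounded (connectedComponentIn (unitTracePlane \ G) m))
    (hd : d ≠ 0) (hd0 : ∑ i, d i = 0) : ∃ t : ℝ, 0 ≤ t ∧ m + t • d ∈ G := by
  by_contra! hcon
  set f : ℝ → Fin 3 → ℝ := fun t => m + t • d with hf
  have hfc : Continuous f := by fun_prop
  have hsub : f '' Set.Ici 0 ⊆ connectedComponentIn (unitTracePlane \ G) m := by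
    refine (isPreconnected_Ici.image f hfc.continuousOn).subset_connectedComponentIn
      ⟨0, Set.self_mem_Ici, by simp [hf]⟩ ?_
    rintro _ ⟨t, ht, rfl⟩
    refine ⟨?_, hcon t ht⟩
    have hm' : ∑ i, m i = 1 := hm
    simp [unitTracePlane, hf, Finset.sum_add_distrib, ← Finset.mul_sum, hd0, hm']
  obtain ⟨ρ, hρ⟩ := (hbd.subset hsub).exists_norm_le
  have hd' : 0 < ‖d‖ := norm_pos_iff.2 hd
  have hρ0 : 0 ≤ ρ := (norm_nonneg _).trans (hρ _ ⟨0, Set.self_mem_Ici, rfl⟩)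
  set t := (ρ + ‖m‖ + 1) / ‖d‖ with ht
  have ht0 : 0 ≤ t := by positivity
  have h1 := hρ _ ⟨t, ht0, rfl⟩
  have h2 : ‖t • d‖ ≤ ‖f t‖ + ‖m‖ := by
    have : t • d = f t - m := by simp [hf]
    rw [this]
    exact norm_sub_le _ _
  rw [norm_smul, Real.norm_of_nonneg ht0, ht, div_mul_cancel₀ _ hd'.ne'] at h2
  linarith

/-- The coordinates of a point between two points of a box lie in the box. -/
theorem apply_mem_Icc_of_ray {a b : ℝ} {m d : Fin 3 → ℝ} {t t' : ℝ} (ht : 0 ≤ t) (ht' : 0 ≤ t')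
    {i : Fin 3} (h : (m + t • d) i ∈ Set.Icc a b) (h' : (m + t' • -d) i ∈ Set.Icc a b) :
    m i ∈ Set.Icc a b := by
  simp only [Pi.add_apply, Pi.smul_apply, Pi.neg_apply, smul_eq_mul, Set.mem_Icc] at h h' ⊢
  rcases le_total 0 (d i) with hd | hd
  · have := mul_nonneg ht hd
    have := mul_nonneg ht' hd
    constructor <;> linarith
  · have := mul_nonpos_of_nonneg_of_nonpos ht hd
    have := mul_nonpos_of_nonneg_of_nonpos ht' hd
    constructor <;> linarith

/-- On a line through the vertex `e = (0, 0, 1)`, a point between two points of the hull, none of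
them beyond the vertex, lies in the hull: suitable multiples of the three diagonal matrices differ
by multiples of `e ⊗ e`. -/
theorem diagonal_mem_relaxedHull_of_line {S : M3} {m e : Fin 3 → ℝ} (he : e = Pi.single 2 1)
    {t t' : ℝ} (ht : 0 < t) (ht' : 0 < t') (ht1 : t < 1)
    (h : Matrix.diagonal (m + t • (e - m)) ∈ relaxedHull S)
    (h' : Matrix.diagonal (m + t' • -(e - m)) ∈ relaxedHull S) :
    Matrix.diagonal m ∈ relaxedHull S := by
  have h1 : 0 < 1 - t := by linarith
  -- multiples of the two given matrices that differ from `diag m` by multiples of `e ⊗ e`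
  set q := t / (1 - t) with hq
  set q' := t' / (1 + t') with hq'
  have hq0 : 0 < q := div_pos ht h1
  have hq0' : 0 < q' := by positivity
  have hB := smul_mem_relaxedHull h (1 - t)⁻¹
  have hC := smul_mem_relaxedHull h' (1 + t')⁻¹
  have eB : (1 - t)⁻¹ • Matrix.diagonal (m + t • (e - m)) = Matrix.diagonal (m + q • e) := by
    rw [← Matrix.diagonal_smul, hq]
    congr 1
    ext i
    simp
    field_simp
    ring
  have eC : (1 + t')⁻¹ • Matrix.diagonal (m + t' • -(e - m)) = Matrix.diagonal (m - q' • e) := by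
    rw [← Matrix.diagonal_smul, hq']
    congr 1
    ext i
    simp
    field_simp
    ring
  rw [eB] at hB
  rw [eC] at hC
  have hrank : Matrix.diagonal (m + q • e) - Matrix.diagonal (m - q' • e) =
      Matrix.vecMulVec ((q + q') • e) e := by
    subst he
    ext i j
    fin_cases i <;> fin_cases j <;> simp [Matrix.vecMulVec_apply]
  have hlam := laminate_mem_relaxedHull (p := q' / (q + q')) hrank hB hC
    ⟨by positivity, by rw [div_le_one (by positivity)]; linarith⟩
  convert hlam using 1
  rw [← Matrix.diagonal_smul, ← Matrix.diagonal_smul, Matrix.diagonal_add]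
  congr 1
  ext i
  simp
  field_simp
  ring

/-- The set enclosed by the curve is attainable: an enclosed point lies on a segment that points
towards the vertex `(0, 0, 1)` and has its end points on the curve. -/
theorem L_subset_attainable (h₁ : 0 < s₁) (h₁₂ : s₁ < s₂) (h₂₃ : s₂ < s₃)
    (hsum : s₁ + s₂ + s₃ = 1) : L s₁ s₂ s₃ ⊆ attainable s₁ s₂ s₃ := by
  have hΓ := Γ_subset_attainable h₁ h₁₂ h₂₃ hsum
  rintro m ⟨hm, hmΓ | hbd⟩
  · exact hΓ hmΓ
  by_cases hmΓ : m ∈ Γ s₁ s₂ s₃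
  · exact hΓ hmΓ
  have hm' : ∑ i, m i = 1 := hm
  have hbox : ∀ d : Fin 3 → ℝ, d ≠ 0 → ∑ i, d i = 0 → ∀ i, m i ∈ Set.Icc s₁ s₃ :=
    fun d hd hd0 i => by
      obtain ⟨t, ht, hA⟩ := exists_ray_mem hm hbd hd hd0
      obtain ⟨t', ht', hB⟩ := exists_ray_mem hm hbd (neg_ne_zero.2 hd) (by simp [hd0])
      exact apply_mem_Icc_of_ray ht ht' ((hΓ hA).2.1 i) ((hΓ hB).2.1 i)
  have hmb : ∀ i, m i ∈ Set.Icc s₁ s₃ := hbox ![1, -1, 0]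
    (fun h => by simpa using congrFun h 0) (by simp [Fin.sum_univ_three])
  refine ⟨?_, hmb, hm'⟩
  set e : Fin 3 → ℝ := Pi.single 2 1 with he
  have hd : e - m ≠ 0 := fun h => by
    have h0 := congrFun h 0
    simp [he] at h0
    linarith [(hmb 0).1]
  have hd0 : ∑ i, (e - m) i = 0 := by
    simp [he, Finset.sum_sub_distrib, hm']
  obtain ⟨t, ht, hA⟩ := exists_ray_mem hm hbd hd hd0
  obtain ⟨t', ht', hB⟩ := exists_ray_mem hm hbd (neg_ne_zero.2 hd) (by
    simp only [Pi.neg_apply, Finset.sum_neg_distrib, hd0, neg_zero])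
  have ht0 : t ≠ 0 := fun h => hmΓ (by simpa [h] using hA)
  have ht0' : t' ≠ 0 := fun h => hmΓ (by simpa [h] using hB)
  -- the segment does not reach the vertex, where the first coordinate vanishes
  have ht1 : t < 1 := by
    have h0 := ((hΓ hA).2.1 0).1
    simp [he] at h0
    nlinarith [(hmb 0).1]
  exact diagonal_mem_relaxedHull_of_line he (ht.lt_of_ne' ht0) (ht'.lt_of_ne' ht0') ht1 (hΓ hA).1
    (hΓ hB).1

end Polycrystal

end

theorem mainTheorem1 (s₁ s₂ s₃ : ℝ) (h₁ : 0 < s₁) (h₁₂ : s₁ < s₂) (h₂₃ : s₂ < s₃)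
    (hsum : s₁ + s₂ + s₃ = 1) :
    Matrix.diagonal '' Polycrystal.L s₁ s₂ s₃ ⊆ Polycrystal.Kstar s₁ s₂ s₃ := by
  rintro _ ⟨m, hm, rfl⟩
  obtain ⟨⟨M, hM⟩, hbox, hsum'⟩ := Polycrystal.L_subset_attainable h₁ h₁₂ h₂₃ hsum hm
  exact ⟨Polycrystal.mem_Kapp_of_relaxedBound (Matrix.isSymm_diagonal m) hM, m, rfl, hbox, hsum'⟩
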